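/- For a measurable set $E\subset\mathbb R^3$ let $|E|$ be its Lebesgue measure, let $\operatorname{Per}E=\sup\{\int_E\nabla\cdot X\,dx:\ X\in C^1_c(\mathbb R^3;\mathbb R^3),\ |X|\le 1\}$ be its perimeter, and let $$D[E]=\frac12\iint_{E\times E}\frac{dx\,dy}{|x-y|},\qquad \mathcal I[E]=\operatorname{Per}E+D[E].$$ For a positive function $\psi:\mathbb S^2\to\mathbb R$ put $\Omega_\psi=\{x\in\mathbb R^3:\ |x|<\psi(x/|x|)\}$ (with $0\in\Omega_\psi$). Let $\nabla$ denote the gradient on $\mathbb S^2$, $\nabla\cdot$ the associated divergence (where applied to fields on $\mathbb S^2$), and $d\omega$ the surface measure on $\mathbb S^2$. Let $\phi:\mathbb S^2\to\mathbb R$ be positive and Lipschitz. Then the following are equivalent. (i) For every Lipschitz $u:\mathbb S^2\to\mathbb R$, the energy $\mathcal I\big[|\Omega_\phi|^{1/3}|\Omega_{\phi+tu}|^{-1/3}\,\Omega_{\phi+tu}\big]$ is finite for all $t$ near $0$, and its derivative with respect to $t$ at $t=0$ exists and satisfies $$\frac{d}{dt}\Big|_{t=0}\mathcal I\big[|\Omega_\phi|^{1/3}|\Omega_{\phi+tu}|^{-1/3}\,\Omega_{\phi+tu}\big]=0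 .$$ (ii) $\phi$ satisfies $$-\nabla\cdot\frac{\nabla\phi}{\phi\sqrt{\phi^2+|\nabla\phi|^2}}+\frac{3}{\sqrt{\phi^2+|\nabla\phi|^2}}-\frac{\sqrt{\phi^2+|\nabla\phi|^2}}{\phi^2}+\int_{\Omega_\phi}\frac{dy}{|\phi(\omega)\omega-y|}=\mu\quad\text{on }\mathbb S^2$$ in the weak sense with $$\mu=|\Omega_\phi|^{-1}\Big(\frac23\operatorname{Per}\Omega_\phi+\frac53D[\Omega_\phi]\Big),$$ that is, for every Lipschitz $v:\mathbb S^2\to\mathbb R$, $$\int_{\mathbb S^2}\Big(\frac{\nabla\phi\cdot\nabla v}{\phi\sqrt{\phi^2+|\nabla\phi|^2}}+\Big(\frac{3}{\sqrt{\phi^2+|\nabla\phi|^2}}-\frac{\sqrt{\phi^2+|\nabla\phi|^2}}{\phi^2}+\int_{\Omega_\phi}\frac{dy}{|\phi(\omega)\omega-y|}\Big)v\Big)d\omega=\mu\int_{\mathbb S^2}v\,d\omega .$$ -/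

import Mathlib

open MeasureTheory Metric Filter Topology
open scoped ENNReal NNReal Pointwise

noncomputable section

namespace LiquidDrop

/-- Euclidean three-space. -/
abbrev E3 : Type := EuclideanSpace ℝ (Fin 3)

/-- The unit sphere in Euclidean three-space (with the chordal metric, which is bi-Lipschitz
equivalent to the geodesic one). -/
abbrev S2 : Type := sphere (0 : E3) 1

/-- Surface measure on the unit sphere. -/
def surf : Measure S2 := (volume : Measure E3).toSphere

lemma norm_inv_smul_mem_sphere {x : E3} (hx : x ≠ 0) : ‖x‖⁻¹ • x ∈ sphere (0 : E3) 1 := by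
  simp [norm_smul, hx]

lemma single_mem_sphere : EuclideanSpace.single (0 : Fin 3) (1 : ℝ) ∈ sphere (0 : E3) 1 := by
  simp

/-- The direction `x / |x|` of `x`. The direction of the origin is an arbitrary fixed unit vector. -/
def dir (x : E3) : S2 :=
  open Classical in
  if hx : x = 0 then ⟨EuclideanSpace.single 0 1, single_mem_sphere⟩
  else ⟨‖x‖⁻¹ • x, norm_inv_smul_mem_sphere hx⟩

/-- The star-shaped set `{x : |x| < φ (x / |x|)}`. -/
def starSet (φ : S2 → ℝ) : Set E3 := {x | ‖x‖ < φ (dir x)}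

/-- The gradient on the unit sphere, as a (tangential) vector of `ℝ³`: the Euclidean gradient at `ω`
of the extension of `φ` which is constant along rays. For a Lipschitz `φ` the extension is
differentiable at almost every point of the sphere. -/
def sphGrad (φ : S2 → ℝ) (ω : S2) : E3 := gradient (fun x : E3 => φ (dir x)) (ω : E3)

/-- The divergence of a vector field on `ℝ³`. -/
def divergence (X : E3 → E3) (x : E3) : ℝ :=
  ∑ i : Fin 3, (fderiv ℝ X x (EuclideanSpace.single i 1)) i

/-- The perimeter of a set in the sense of De Giorgi. -/
def perimeter (E : Set E3) : ℝ≥0∞ :=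
  ⨆ (X : E3 → E3) (_ : ContDiff ℝ 1 X ∧ HasCompactSupport X ∧ ∀ x, ‖X x‖ ≤ 1),
    ENNReal.ofReal (∫ x in E, divergence X x)

/-- The Coulomb energy `D[E] = 1/2 ∬_{E × E} dx dy / |x - y|`. -/
def coulomb (E : Set E3) : ℝ≥0∞ :=
  2⁻¹ * ∫⁻ x in E, ∫⁻ y in E, ENNReal.ofReal (1 / ‖x - y‖)

/-- The liquid drop energy `I[E] = Per E + D[E]`. -/
def energy (E : Set E3) : ℝ≥0∞ := perimeter E + coulomb E

/-- The perturbed set `|Ω_φ|^{1/3} |Ω_{φ+tu}|^{-1/3} Ω_{φ+tu}`. -/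
def perturbedSet (φ u : S2 → ℝ) (t : ℝ) : Set E3 :=
  (volume.real (starSet φ) ^ (1 / 3 : ℝ) *
      volume.real (starSet (fun ω => φ ω + t * u ω)) ^ (-(1 / 3) : ℝ)) •
    starSet (fun ω => φ ω + t * u ω)

/-- For every Lipschitz `u`, the energy of the volume-normalized perturbations is finite for all
small `t`, and its derivative at `t = 0` exists and vanishes. -/
def IsCritical (φ : S2 → ℝ) : Prop :=
  ∀ u : S2 → ℝ, (∃ K : ℝ≥0, LipschitzWith K u) →
    (∀ᶠ t in 𝓝 (0 : ℝ), energy (perturbedSet φ u t) ≠ ∞) ∧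
      HasDerivAt (fun t : ℝ => (energy (perturbedSet φ u t)).toReal) 0 0

/-- The function `√(φ² + |∇φ|²)` on the sphere. -/
def slope (φ : S2 → ℝ) (ω : S2) : ℝ := √(φ ω ^ 2 + ‖sphGrad φ ω‖ ^ 2)

/-- The potential `∫_{Ω_φ} dy / |φ(ω) ω - y|`. -/
def potential (φ : S2 → ℝ) (ω : S2) : ℝ :=
  ∫ y in starSet φ, 1 / ‖φ ω • (ω : E3) - y‖

/-- The equation
`-∇ · (∇φ / (φ √(φ² + |∇φ|²))) + 3 / √(φ² + |∇φ|²) - √(φ² + |∇φ|²) / φ² + potential = μ`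
on the sphere in the weak sense, tested with Lipschitz functions. -/
def IsWeakSolution (φ : S2 → ℝ) (μ : ℝ) : Prop :=
  ∀ v : S2 → ℝ, (∃ K : ℝ≥0, LipschitzWith K v) →
    ∫ ω, (inner ℝ (sphGrad φ ω) (sphGrad v ω) / (φ ω * slope φ ω)
        + (3 / slope φ ω - slope φ ω / φ ω ^ 2 + potential φ ω) * v ω) ∂surf
      = ∫ ω, μ * v ω ∂surf

/-- The multiplier `|Ω_φ|⁻¹ (2/3 Per Ω_φ + 5/3 D[Ω_φ])`. -/
def multiplier (φ : S2 → ℝ) : ℝ :=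
  (volume.real (starSet φ))⁻¹ *
    (2 / 3 * (perimeter (starSet φ)).toReal + 5 / 3 * (coulomb (starSet φ)).toReal)

end LiquidDrop

end

noncomputable section

namespace LiquidDrop

/-! On a star-shaped Lipschitz set every term of the energy has an explicit first variation.
Dilation by c multiplies the perimeter by c² and the Coulomb energy by c⁵, so the normalized energy
is c(t)² P(t) + c(t)⁵ D(t) with c = (V(0)/V)^(1/3), where P, D, V belong to φ + tu. Since c(0) = 1
and c'(0) = -V'(0)/(3V(0)), its derivative at 0 is P' + D' - μV' with exactly the stated multiplier
μ (`hasDerivAt_energy_perturbedSet`). Here V' = ∫ φ²u, D' = ∫ φ²u · potential, and P' comes from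
differentiating ∫ φ√(φ² + |∇φ|²). With v = φ²u this is the weak form of the equation
(`integral_weakForm_eq`), and u ↦ φ²u is a bijection of the Lipschitz functions because φ is
Lipschitz and bounded below.

Two inputs need work. The De Giorgi perimeter is identified in `perimeter_starSet`. Gauss–Green is
obtained by integrating by parts against a cut-off of the gauge |x|/φ(x/|x|): the gauge is Lipschitz
and 1-homogeneous, so its derivative is constant along rays, and thin shell integrals converge to an
integral over the sphere. Cauchy–Schwarz bounds the supremum from above; smooth L¹ approximations of
the unit normal attain it in the limit.

For the Coulomb energy, replacing A by B changes D by the linear term ∫_B N_A - ∫_A N_A, with N_A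
the Newtonian potential, up to a remainder quadratic in 1_B - 1_A. Splitting the kernel at distance
√|t| makes that remainder O(|t|^(3/2)) (`abs_coulomb_sub_le`), so only the integral of a fixed
continuous function over a moving star-shaped set has to be differentiated. -/

instance : IsFiniteMeasure surf := inferInstanceAs (IsFiniteMeasure (volume : Measure E3).toSphere)

/-! ### Directions and polar coordinates -/

lemma dir_smul_coe {r : ℝ} (hr : 0 < r) (ω : S2) : dir (r • (ω : E3)) = ω := by
  have hω : ‖(ω : E3)‖ = 1 := by simp
  have h0 : r • (ω : E3) ≠ 0 := by
    rw [← norm_ne_zero_iff, norm_smul, hω, Real.norm_of_nonneg hr.le]; simpa using hr.ne'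
  apply Subtype.ext
  simp [dir, h0, norm_smul, abs_of_pos hr, smul_smul, hr.ne']

lemma dir_coe (ω : S2) : dir (ω : E3) = ω := by
  simpa using dir_smul_coe one_pos ω

lemma dir_smul {r : ℝ} (hr : 0 < r) (x : E3) : dir (r • x) = dir x := by
  by_cases hx : x = 0
  · simp [hx]
  apply Subtype.ext
  simp [dir, hx, hr.ne', norm_smul, abs_of_pos hr, smul_smul]

lemma norm_coe (ω : S2) : ‖(ω : E3)‖ = 1 := by simp

lemma coe_ne_zero (ω : S2) : (ω : E3) ≠ 0 := by
  rw [← norm_ne_zero_iff, norm_coe]; exact one_ne_zero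

lemma norm_smul_coe {r : ℝ} (hr : 0 ≤ r) (ω : S2) : ‖r • (ω : E3)‖ = r := by
  rw [norm_smul, norm_coe, mul_one, Real.norm_of_nonneg hr]

lemma norm_smul_dir (x : E3) : ‖x‖ • (dir x : E3) = x := by
  by_cases hx : x = 0
  · simp [hx]
  · simp [dir, hx, smul_smul]

lemma measurable_dir : Measurable dir := by
  have h : Measurable (fun x => (dir x : E3)) := by
    have : (fun x => (dir x : E3)) = fun x => open Classical in
        if x = 0 then EuclideanSpace.single 0 1 else ‖x‖⁻¹ • x := by
      funext x
      by_cases hx : x = 0 <;> simp [dir, hx]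
    rw [this]
    exact Measurable.ite (measurableSet_singleton _) measurable_const (by fun_prop)
  exact h.subtype_mk

/-- The point with given direction and radius. -/
def polar (p : S2 × Set.Ioi (0 : ℝ)) : E3 := (p.2 : ℝ) • (p.1 : E3)

lemma polar_eq : polar = Subtype.val ∘ (homeomorphUnitSphereProd E3).symm := by
  funext p; simp [polar]

lemma measurableEmbedding_polar : MeasurableEmbedding polar := by
  rw [polar_eq]
  exact (MeasurableEmbedding.subtype_coe (measurableSet_singleton _).compl).comp
      (Homeomorph.measurableEmbedding _)

lemma measurePreserving_polar :
    MeasurePreserving polar (surf.prod (Measure.volumeIoiPow 2)) volume := by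
  have h1 := (volume : Measure E3).measurePreserving_homeomorphUnitSphereProd
  have h2 : MeasurePreserving (homeomorphUnitSphereProd E3).symm
      (surf.prod (Measure.volumeIoiPow 2)) ((volume : Measure E3).comap Subtype.val) := by
    have := MeasurePreserving.symm (homeomorphUnitSphereProd E3).toMeasurableEquiv h1
    simpa [surf] using this
  have h3 : MeasurePreserving (Subtype.val : ({0}ᶜ : Set E3) → E3)
      ((volume : Measure E3).comap Subtype.val) volume := by
    have := measurePreserving_subtype_coe (μa := (volume : Measure E3))
      (measurableSet_singleton (0 : E3)).compl
    rwa [restrict_compl_singleton] at this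
  rw [polar_eq]
  exact h3.comp h2

lemma integral_volumeIoiPow (n : ℕ) (f : ℝ → ℝ) :
    ∫ r : Set.Ioi (0 : ℝ), f r ∂(Measure.volumeIoiPow n) = ∫ r in Set.Ioi (0 : ℝ), r ^ n * f r := by
  simp only [Measure.volumeIoiPow, ENNReal.ofReal]
  rw [integral_withDensity_eq_integral_smul,
    integral_subtype_comap measurableSet_Ioi fun a ↦ Real.toNNReal (a ^ n) • f a,
    setIntegral_congr_fun measurableSet_Ioi fun x hx ↦ ?_]
  · simp only [NNReal.smul_def, Real.coe_toNNReal _ (pow_nonneg (Set.mem_Ioi.1 hx).le _), smul_eq_mul]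
  · exact (measurable_subtype_coe.pow_const _).real_toNNReal

lemma integral_polar {f : E3 → ℝ} (hf : Integrable f) :
    ∫ x, f x = ∫ ω : S2, (∫ r in Set.Ioi (0 : ℝ), r ^ 2 * f (r • (ω : E3))) ∂surf := by
  rw [← measurePreserving_polar.integral_comp measurableEmbedding_polar]
  rw [integral_prod (fun z => f (polar z)) ((measurePreserving_polar.integrable_comp_emb measurableEmbedding_polar).2 hf)]
  congr 1 with ω
  exact integral_volumeIoiPow 2 (fun r => f (r • (ω : E3)))

lemma mem_starSet_smul {ψ : S2 → ℝ} {r : ℝ} (hr : 0 < r) (ω : S2) :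
    r • (ω : E3) ∈ starSet ψ ↔ r < ψ ω := by
  simp [starSet, dir_smul_coe hr, norm_smul_coe hr.le]

lemma measurableSet_starSet {ψ : S2 → ℝ} (hψ : Measurable ψ) : MeasurableSet (starSet ψ) :=
  measurableSet_lt measurable_norm (hψ.comp measurable_dir)

/-- Integration over a star-shaped set in polar coordinates. -/
lemma setIntegral_starSet {ψ : S2 → ℝ} (hψ : Measurable ψ) (h0 : ∀ ω, 0 ≤ ψ ω) {f : E3 → ℝ}
    (hf : IntegrableOn f (starSet ψ)) :
    ∫ x in starSet ψ, f x = ∫ ω : S2, (∫ r in 0..ψ ω, r ^ 2 * f (r • (ω : E3))) ∂surf := by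
  have hm := measurableSet_starSet hψ
  rw [← integral_indicator hm, integral_polar ((integrable_indicator_iff hm).2 hf)]
  congr 1 with ω
  rw [intervalIntegral.integral_of_le (h0 ω), integral_Ioc_eq_integral_Ioo,
    ← integral_indicator measurableSet_Ioi, ← integral_indicator measurableSet_Ioo]
  congr 1 with r
  by_cases hr : 0 < r
  · by_cases h : r < ψ ω
    · simp [hr, h, Set.indicator, mem_starSet_smul hr]
    · simp [hr, h, Set.indicator, mem_starSet_smul hr]
  · simp [hr, Set.indicator]

/-- A property of almost every point of space holds somewhere on almost every ray. -/
lemma ae_surf_of_ae {p : E3 → Prop} (hp : ∀ᵐ x, p x) :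
    ∀ᵐ (ω : S2) ∂surf, ∃ r : ℝ, 0 < r ∧ p (r • (ω : E3)) := by
  have h1 : ∀ᵐ q ∂(surf.prod (Measure.volumeIoiPow 2)), p (polar q) :=
    measurePreserving_polar.quasiMeasurePreserving.ae hp
  have h2 := Measure.ae_ae_of_ae_prod h1
  filter_upwards [h2] with ω hω
  have : (ae (Measure.volumeIoiPow 2)).NeBot := by
    rw [ae_neBot]
    intro h
    -- The interval (0, 1) has radial measure 1/3, so the radial measure is nonzero.
    have := Measure.volumeIoiPow_apply_Iio 2 ⟨1, by simp⟩
    rw [h] at this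
    simp at this
    norm_num at this
  obtain ⟨r, hr⟩ := hω.exists
  exact ⟨r, r.2, hr⟩

/-! ### Lipschitz functions on the sphere -/

/-- A function on the sphere which is Lipschitz with some constant. -/
abbrev IsLip (f : S2 → ℝ) : Prop := ∃ K : ℝ≥0, LipschitzWith K f

instance : Nonempty S2 := ⟨dir 0⟩

lemma IsLip.continuous {f : S2 → ℝ} (hf : IsLip f) : Continuous f := hf.choose_spec.continuous

lemma exists_bound_of_continuous {f : S2 → ℝ} (hf : Continuous f) : ∃ M, 0 < M ∧ ∀ ω, |f ω| ≤ M := by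
  obtain ⟨M, hM⟩ := isCompact_univ.exists_bound_of_continuousOn hf.continuousOn
  exact ⟨max M 1, by positivity, fun ω => (hM ω (Set.mem_univ _)).trans (le_max_left _ _)⟩

lemma integrable_of_continuous {f : S2 → ℝ} (hf : Continuous f) : Integrable f surf := by
  obtain ⟨B, hB, hb⟩ := exists_bound_of_continuous hf
  exact Integrable.of_bound hf.aestronglyMeasurable B (Eventually.of_forall hb)

lemma exists_pos_le_of_continuous {f : S2 → ℝ} (hf : Continuous f) (h : ∀ ω, 0 < f ω) :
    ∃ m, 0 < m ∧ ∀ ω, m ≤ f ω := by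
  obtain ⟨ω, -, hω⟩ := isCompact_univ.exists_isMinOn Set.univ_nonempty hf.continuousOn
  exact ⟨f ω, h ω, fun ω' => hω (Set.mem_univ ω')⟩

lemma isLip_of_dist_le {f : S2 → ℝ} (K : ℝ) (h : ∀ x y, |f x - f y| ≤ K * dist x y) : IsLip f := by
  refine ⟨K.toNNReal, LipschitzWith.of_dist_le_mul fun x y => (h x y).trans ?_⟩
  gcongr
  exact Real.le_coe_toNNReal K

lemma IsLip.abs_sub_le {f : S2 → ℝ} (hf : IsLip f) : ∃ K : ℝ, 0 ≤ K ∧ ∀ x y, |f x - f y| ≤ K * dist x y :=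
  ⟨hf.choose, hf.choose.2, fun x y => hf.choose_spec.dist_le_mul x y⟩

lemma IsLip.add {f g : S2 → ℝ} (hf : IsLip f) (hg : IsLip g) : IsLip (fun ω => f ω + g ω) :=
  ⟨_, hf.choose_spec.add hg.choose_spec⟩

lemma IsLip.mul {f g : S2 → ℝ} (hf : IsLip f) (hg : IsLip g) : IsLip (fun ω => f ω * g ω) := by
  obtain ⟨A, hA, hfA⟩ := exists_bound_of_continuous hf.continuous
  obtain ⟨B, hB, hgB⟩ := exists_bound_of_continuous hg.continuous
  obtain ⟨K, hK, hf⟩ := hf.abs_sub_le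
  obtain ⟨L, hL, hg⟩ := hg.abs_sub_le
  refine isLip_of_dist_le (A * L + K * B) fun x y => ?_
  calc |f x * g x - f y * g y| = |f x * (g x - g y) + (f x - f y) * g y| := by ring_nf
    _ ≤ |f x| * |g x - g y| + |f x - f y| * |g y| := by
      rw [← abs_mul, ← abs_mul]; exact abs_add_le _ _
    _ ≤ A * (L * dist x y) + K * dist x y * B := by
      gcongr
      · exact hfA x
      · exact hg x y
      · exact hf x y
      · exact hgB y
    _ = _ := by ring

lemma IsLip.const (c : ℝ) : IsLip (fun _ => c) := ⟨0, LipschitzWith.const c⟩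

lemma IsLip.inv {f : S2 → ℝ} (hf : IsLip f) (hpos : ∀ ω, 0 < f ω) : IsLip (fun ω => (f ω)⁻¹) := by
  obtain ⟨m, hm, hfm⟩ := exists_pos_le_of_continuous hf.continuous hpos
  obtain ⟨K, hK, hf⟩ := hf.abs_sub_le
  refine isLip_of_dist_le (K * (m⁻¹ * m⁻¹)) fun x y => ?_
  have hx := hpos x
  have hy := hpos y
  have e : (f x)⁻¹ - (f y)⁻¹ = (f y - f x) * ((f x)⁻¹ * (f y)⁻¹) := by field_simp
  rw [e, abs_mul, abs_sub_comm, abs_of_pos (a := (f x)⁻¹ * (f y)⁻¹) (by positivity)]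
  calc _ ≤ (K * dist x y) * (m⁻¹ * m⁻¹) := by
        gcongr
        · exact hf x y
        · exact hfm x
        · exact hfm y
    _ = _ := by ring

/-! ### Homogeneous extensions and the spherical gradient -/

/-- The weight ‖y‖ turns directions back into points: ‖y‖(dir x - dir y) = (‖y‖ - ‖x‖) dir x + (x -
y). This form also covers the origin, whose direction is arbitrary. -/
lemma norm_mul_dist_dir_le (x y : E3) : ‖y‖ * dist (dir x) (dir y) ≤ 2 * ‖x - y‖ := by
  rw [Subtype.dist_eq, dist_eq_norm]
  have e : ‖y‖ • ((dir x : E3) - dir y) = (‖y‖ - ‖x‖) • (dir x : E3) + (x - y) := by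
    rw [smul_sub, norm_smul_dir, sub_smul, norm_smul_dir]; abel
  calc ‖y‖ * ‖(dir x : E3) - dir y‖ = ‖‖y‖ • ((dir x : E3) - dir y)‖ := by
        rw [norm_smul, norm_norm]
    _ ≤ ‖(‖y‖ - ‖x‖) • (dir x : E3)‖ + ‖x - y‖ := by rw [e]; exact norm_add_le _ _
    _ = |‖x‖ - ‖y‖| + ‖x - y‖ := by
        rw [norm_smul, norm_coe, mul_one, Real.norm_eq_abs, abs_sub_comm]
    _ ≤ 2 * ‖x - y‖ := by linarith [abs_norm_sub_norm_le x y]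

/-- The extension of a Lipschitz function on the sphere to a positively `1`-homogeneous function
is Lipschitz. -/
lemma IsLip.lipschitzWith_homogeneous {f : S2 → ℝ} (hf : IsLip f) :
    ∃ C : ℝ≥0, LipschitzWith C (fun x : E3 => ‖x‖ * f (dir x)) := by
  obtain ⟨M, hM, hfM⟩ := exists_bound_of_continuous hf.continuous
  obtain ⟨K, hK, hf⟩ := hf.abs_sub_le
  refine ⟨(M + 2 * K).toNNReal, LipschitzWith.of_dist_le_mul fun x y => ?_⟩
  rw [Real.coe_toNNReal _ (by positivity), Real.dist_eq, dist_eq_norm]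
  calc |‖x‖ * f (dir x) - ‖y‖ * f (dir y)|
      = |(‖x‖ - ‖y‖) * f (dir x) + ‖y‖ * (f (dir x) - f (dir y))| := by ring_nf
    _ ≤ |‖x‖ - ‖y‖| * |f (dir x)| + ‖y‖ * |f (dir x) - f (dir y)| := by
      refine (abs_add_le _ _).trans (by rw [abs_mul, abs_mul, abs_norm])
    _ ≤ ‖x - y‖ * M + ‖y‖ * (K * dist (dir x) (dir y)) := by
      gcongr
      · exact abs_norm_sub_norm_le x y
      · exact hfM _
      · exact hf _ _
    _ = ‖x - y‖ * M + K * (‖y‖ * dist (dir x) (dir y)) := by ring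
    _ ≤ ‖x - y‖ * M + K * (2 * ‖x - y‖) := by
      gcongr ‖x - y‖ * M + K * ?_
      exact norm_mul_dist_dir_le x y
    _ = (M + 2 * K) * ‖x - y‖ := by ring

/-- The positively `0`-homogeneous extension of a Lipschitz function on the sphere is differentiable
at almost every point of the sphere. -/
lemma IsLip.ae_differentiableAt {f : S2 → ℝ} (hf : IsLip f) :
    ∀ᵐ (ω : S2) ∂surf, DifferentiableAt ℝ (fun x : E3 => f (dir x)) (ω : E3) := by
  obtain ⟨C, hC⟩ := hf.lipschitzWith_homogeneous
  -- Rademacher gives differentiability at almost every point of space. One such point on a ray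
  -- suffices: dividing by the norm and dilating carries differentiability to the point of the ray
  -- on the sphere.
  filter_upwards [ae_surf_of_ae hC.ae_differentiableAt] with ω ⟨r, hr, h⟩
  have h0 : r • (ω : E3) ≠ 0 := smul_ne_zero hr.ne' (coe_ne_zero ω)
  have h1 : DifferentiableAt ℝ (fun x : E3 => f (dir x)) (r • (ω : E3)) := by
    have h2 : DifferentiableAt ℝ (fun x : E3 => ‖x‖⁻¹ * (‖x‖ * f (dir x))) (r • (ω : E3)) :=
      ((differentiableAt_id.norm ℝ h0).inv (norm_ne_zero_iff.2 h0)).mul h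
    refine h2.congr_of_eventuallyEq ?_
    filter_upwards [isOpen_ne.mem_nhds h0] with x hx
    field_simp [norm_ne_zero_iff.2 hx]
  have h3 : DifferentiableAt ℝ (fun x : E3 => r • x) (ω : E3) := by fun_prop
  have h4 := DifferentiableAt.comp (ω : E3) h1 h3
  refine h4.congr_of_eventuallyEq (Eventually.of_forall fun x => ?_)
  simp [dir_smul hr]

lemma sphGrad_eq_of_hasFDerivAt {f : S2 → ℝ} {ω : S2} {L : E3 →L[ℝ] ℝ}
    (h : HasFDerivAt (fun x : E3 => f (dir x)) L (ω : E3)) :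
    sphGrad f ω = (InnerProductSpace.toDual ℝ E3).symm L := by
  rw [sphGrad, gradient, h.fderiv]

lemma inner_sphGrad (f : S2 → ℝ) (ω : S2) (v : E3) :
    inner ℝ (sphGrad f ω) v = fderiv ℝ (fun x : E3 => f (dir x)) (ω : E3) v := by
  rw [sphGrad, gradient, InnerProductSpace.toDual_symm_apply]

/-- The extension is constant along rays, so its radial derivative vanishes. Where it is not
differentiable the gradient is 0 by default. -/
lemma inner_sphGrad_coe (f : S2 → ℝ) (ω : S2) : inner ℝ (sphGrad f ω) (ω : E3) = 0 := by
  rw [inner_sphGrad]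
  by_cases h : DifferentiableAt ℝ (fun x : E3 => f (dir x)) (ω : E3)
  · have h1 := h.hasFDerivAt.hasLineDerivAt (ω : E3)
    have h2 : HasLineDerivAt ℝ (fun x : E3 => f (dir x)) 0 (ω : E3) (ω : E3) := by
      have : HasDerivAt (fun _ : ℝ => f ω) 0 0 := hasDerivAt_const _ _
      refine this.congr_of_eventuallyEq ?_
      filter_upwards [isOpen_lt continuous_const continuous_id |>.mem_nhds
        (show (-1 : ℝ) < 0 by norm_num)] with t ht
      have : (ω : E3) + t • (ω : E3) = (1 + t) • (ω : E3) := by rw [add_smul, one_smul]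
      rw [this, dir_smul_coe (by simp at ht; linarith)]
    exact h1.unique h2
  · simp [fderiv_zero_of_not_differentiableAt h]

lemma IsLip.norm_sphGrad_le {f : S2 → ℝ} (hf : IsLip f) : ∃ C, 0 ≤ C ∧ ∀ ω, ‖sphGrad f ω‖ ≤ C := by
  obtain ⟨K, hK, hf⟩ := hf.abs_sub_le
  refine ⟨(4 * K).toNNReal, NNReal.coe_nonneg _, fun ω => ?_⟩
  rw [sphGrad, gradient, LinearIsometryEquiv.norm_map]
  -- On the ball of radius 1/2 about ω one has ‖y‖ ≥ 1/2, so `dir` is 4-Lipschitz there.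
  refine norm_fderiv_le_of_lipschitzOn ℝ (ball_mem_nhds (ω : E3) (show (0 : ℝ) < 1 / 2 by norm_num))
    (LipschitzOnWith.of_dist_le_mul fun x _ y hy => ?_)
  rw [Real.coe_toNNReal _ (by positivity), Real.dist_eq]
  have hy' : 1 / 2 ≤ ‖y‖ := by
    have := norm_sub_norm_le (ω : E3) y
    rw [norm_coe, ← dist_eq_norm, dist_comm] at this
    linarith [mem_ball.1 hy]
  have h1 := norm_mul_dist_dir_le x y
  have h2 : dist (dir x) (dir y) ≤ 4 * dist x y := by
    rw [dist_eq_norm x y]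
    nlinarith [dist_nonneg (x := dir x) (y := dir y)]
  calc _ ≤ K * dist (dir x) (dir y) := hf _ _
    _ ≤ K * (4 * dist x y) := by gcongr
    _ = _ := by ring

lemma measurable_sphGrad (f : S2 → ℝ) : Measurable (sphGrad f) :=
  (InnerProductSpace.toDual ℝ E3).symm.continuous.measurable.comp
    ((measurable_fderiv ℝ (fun x : E3 => f (dir x))).comp measurable_subtype_coe)

lemma sphGrad_add_mul {f g : S2 → ℝ} {ω : S2}
    (hf : DifferentiableAt ℝ (fun x : E3 => f (dir x)) (ω : E3))
    (hg : DifferentiableAt ℝ (fun x : E3 => g (dir x)) (ω : E3)) (t : ℝ) :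
    sphGrad (fun ω => f ω + t * g ω) ω = sphGrad f ω + t • sphGrad g ω := by
  rw [sphGrad_eq_of_hasFDerivAt (hf.hasFDerivAt.add (hg.hasFDerivAt.const_mul t))]
  simp [sphGrad, gradient]

lemma sphGrad_mul {f g : S2 → ℝ} {ω : S2}
    (hf : DifferentiableAt ℝ (fun x : E3 => f (dir x)) (ω : E3))
    (hg : DifferentiableAt ℝ (fun x : E3 => g (dir x)) (ω : E3)) :
    sphGrad (fun ω => f ω * g ω) ω = f ω • sphGrad g ω + g ω • sphGrad f ω := by
  rw [sphGrad_eq_of_hasFDerivAt (hf.hasFDerivAt.mul hg.hasFDerivAt)]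
  simp [sphGrad, gradient, dir_coe]

/-- No differentiability is needed, in contrast to sums and products: a nonzero factor preserves
non-differentiability, and the default value 0 scales as well. -/
lemma sphGrad_const_mul (f : S2 → ℝ) (ω : S2) (c : ℝ) :
    sphGrad (fun ω => c * f ω) ω = c • sphGrad f ω := by
  have : fderiv ℝ (fun x : E3 => c * f (dir x)) (ω : E3) =
      c • fderiv ℝ (fun x : E3 => f (dir x)) (ω : E3) :=
    congrFun (fderiv_const_smul_field (𝕜 := ℝ) (f := fun x : E3 => f (dir x)) c) _
  simp [sphGrad, gradient, this]

/-! ### The gauge of a star-shaped set -/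

/-- The gauge of the star-shaped set of `φ`. -/
def starGauge (φ : S2 → ℝ) (x : E3) : ℝ := ‖x‖ * (φ (dir x))⁻¹

lemma starGauge_smul (φ : S2 → ℝ) {r : ℝ} (hr : 0 < r) (x : E3) :
    starGauge φ (r • x) = r * starGauge φ x := by
  simp [starGauge, dir_smul hr, norm_smul, abs_of_pos hr, mul_assoc]

lemma starGauge_smul_coe (φ : S2 → ℝ) {r : ℝ} (hr : 0 < r) (ω : S2) :
    starGauge φ (r • (ω : E3)) = r / φ ω := by
  simp [starGauge, dir_smul_coe hr, norm_smul, abs_of_pos hr, div_eq_mul_inv]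

lemma starGauge_lt_one_iff {φ : S2 → ℝ} (hpos : ∀ ω, 0 < φ ω) (x : E3) :
    starGauge φ x < 1 ↔ x ∈ starSet φ := by
  have := hpos (dir x)
  rw [starGauge, ← div_eq_mul_inv, div_lt_one this]; rfl

lemma exists_lipschitzWith_starGauge {φ : S2 → ℝ} (hpos : ∀ ω, 0 < φ ω) (hφ : IsLip φ) :
    ∃ C : ℝ≥0, LipschitzWith C (starGauge φ) :=
  (hφ.inv hpos).lipschitzWith_homogeneous

/-- The derivative of a 1-homogeneous function is 0-homogeneous. This lets it be pulled out of
radial integrals. -/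
lemma hasFDerivAt_starGauge_smul {φ : S2 → ℝ} {x : E3} {L : E3 →L[ℝ] ℝ}
    (h : HasFDerivAt (starGauge φ) L x) {r : ℝ} (hr : 0 < r) :
    HasFDerivAt (starGauge φ) L (r • x) := by
  have h1 : HasFDerivAt (fun y : E3 => r⁻¹ • y) (r⁻¹ • ContinuousLinearMap.id ℝ E3) (r • x) :=
    (hasFDerivAt_id (𝕜 := ℝ) (r • x)).fun_const_smul r⁻¹
  have h2 : HasFDerivAt (starGauge φ) L (r⁻¹ • (r • x)) := by
    rwa [smul_smul, inv_mul_cancel₀ hr.ne', one_smul]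
  have h3 := (h2.comp (r • x) h1).const_mul r
  have e : (fun y : E3 => r * (starGauge φ ∘ fun y : E3 => r⁻¹ • y) y) = starGauge φ := by
    funext y
    simp [starGauge_smul φ (inv_pos.2 hr), hr.ne']
  rw [e] at h3
  refine h3.congr_fderiv ?_
  ext v
  simp [hr.ne']

/-- Product rule for |x| · 1/φ(dir x). Multiplied by φ³, the gradient found here becomes
`normalField φ ω`. -/
lemma hasFDerivAt_starGauge {φ : S2 → ℝ} (hpos : ∀ ω, 0 < φ ω) {ω : S2}
    (h : DifferentiableAt ℝ (fun x : E3 => φ (dir x)) (ω : E3)) :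
    HasFDerivAt (starGauge φ) (InnerProductSpace.toDual ℝ E3
      ((φ ω)⁻¹ • (ω : E3) - ((φ ω) ^ 2)⁻¹ • sphGrad φ ω)) (ω : E3) := by
  have h0 : φ (dir (ω : E3)) ≠ 0 := (hpos _).ne'
  have h1 : HasFDerivAt (fun x : E3 => ‖x‖) (InnerProductSpace.toDual ℝ E3 (ω : E3)) (ω : E3) := by
    have h2 := (hasStrictFDerivAt_norm_sq (ω : E3)).hasFDerivAt.sqrt (by simp)
    simp only [Real.sqrt_sq (norm_nonneg _), norm_coe] at h2
    refine h2.congr_fderiv ?_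
    ext v
    simp
  have h2 : HasFDerivAt (fun x : E3 => (φ (dir x))⁻¹) _ (ω : E3) :=
    (hasDerivAt_inv h0).hasFDerivAt.comp (ω : E3) h.hasFDerivAt
  refine (h1.mul h2).congr_fderiv ?_
  ext v
  simp [inner_sphGrad, dir_coe]
  ring

/-! ### The Gauss–Green formula -/

lemma continuous_radialIntegral {f : E3 → ℝ} (hf : Continuous f) {ψ : S2 → ℝ} (hψ : Continuous ψ) :
    Continuous (fun ω : S2 => ∫ r in 0..ψ ω, r ^ 2 * f (r • (ω : E3))) := by
  apply intervalIntegral.continuous_parametric_intervalIntegral_of_continuous _ hψ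
  simp only [Function.uncurry_def]
  fun_prop

/-- A piecewise linear cut-off, equal to `1` for `s ≤ 1 - ε` and to `0` for `1 ≤ s`. -/
def cutoff (ε s : ℝ) : ℝ := max 0 (min 1 (ε⁻¹ * (1 - s)))

lemma cutoff_nonneg (ε s : ℝ) : 0 ≤ cutoff ε s := le_max_left _ _

lemma cutoff_le_one (ε s : ℝ) : cutoff ε s ≤ 1 := max_le zero_le_one (min_le_left _ _)

lemma cutoff_of_one_le {ε s : ℝ} (hε : 0 < ε) (hs : 1 ≤ s) : cutoff ε s = 0 := by
  have : ε⁻¹ * (1 - s) ≤ 0 := mul_nonpos_of_nonneg_of_nonpos (by positivity) (by linarith)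
  exact max_eq_left ((min_le_right _ _).trans this)

lemma cutoff_of_le {ε s : ℝ} (hε : 0 < ε) (hs : s ≤ 1 - ε) : cutoff ε s = 1 := by
  have : 1 ≤ ε⁻¹ * (1 - s) := by
    rw [inv_mul_eq_div, le_div_iff₀ hε]; linarith
  rw [cutoff, min_eq_left this]; simp

lemma cutoff_of_mem {ε s : ℝ} (hε : 0 < ε) (h1 : 1 - ε ≤ s) (h2 : s ≤ 1) :
    cutoff ε s = ε⁻¹ * (1 - s) := by
  have h3 : ε⁻¹ * (1 - s) ≤ 1 := by
    rw [inv_mul_eq_div, div_le_iff₀ hε]; linarith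
  have h4 : 0 ≤ ε⁻¹ * (1 - s) := mul_nonneg (by positivity) (by linarith)
  rw [cutoff, min_eq_right h3, max_eq_right h4]

lemma lipschitzWith_cutoff {ε : ℝ} : LipschitzWith (ε⁻¹).nnabs (cutoff ε) := by
  have h : LipschitzWith (ε⁻¹).nnabs (fun s : ℝ => ε⁻¹ * (1 - s)) := by
    refine LipschitzWith.of_dist_le_mul fun x y => ?_
    rw [Real.dist_eq, Real.dist_eq, ← mul_sub, abs_mul, Real.coe_nnabs]
    rw [show 1 - x - (1 - y) = -(x - y) by ring, abs_neg]
  exact (h.const_min 1).const_max 0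

lemma hasDerivAt_cutoff {ε s : ℝ} (hε : 0 < ε) (h1 : s ≠ 1) (h2 : s ≠ 1 - ε) :
    HasDerivAt (cutoff ε) ((Set.Ioo (1 - ε) 1).indicator (fun _ => -ε⁻¹) s) s := by
  rcases lt_or_gt_of_ne h2 with h | h
  · rw [Set.indicator_of_notMem (by simp [h.le])]
    refine (hasDerivAt_const s (1 : ℝ)).congr_of_eventuallyEq ?_
    filter_upwards [Iio_mem_nhds h] with t ht using cutoff_of_le hε (le_of_lt ht)
  rcases lt_or_gt_of_ne h1 with h' | h'
  · rw [Set.indicator_of_mem (Set.mem_Ioo.2 ⟨h, h'⟩)]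
    have : HasDerivAt (fun t => ε⁻¹ * (1 - t)) (-ε⁻¹) s := by
      simpa using ((hasDerivAt_id s).const_sub 1).const_mul ε⁻¹
    refine this.congr_of_eventuallyEq ?_
    filter_upwards [Ioo_mem_nhds h h'] with t ht using cutoff_of_mem hε ht.1.le ht.2.le
  · rw [Set.indicator_of_notMem (by simp [h'.le])]
    refine (hasDerivAt_const s (0 : ℝ)).congr_of_eventuallyEq ?_
    filter_upwards [Ioi_mem_nhds h'] with t ht using cutoff_of_one_le hε (le_of_lt ht)

lemma ae_differentiableAt_starGauge {φ : S2 → ℝ} (hpos : ∀ ω, 0 < φ ω) (hφ : IsLip φ) :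
    ∀ᵐ (ω : S2) ∂surf, DifferentiableAt ℝ (starGauge φ) (ω : E3) := by
  filter_upwards [hφ.ae_differentiableAt] with ω h using (hasFDerivAt_starGauge hpos h).differentiableAt

/-- Integration by parts against a cut-off of the star-shaped set. -/
lemma integral_fderiv_mul_cutoff {φ : S2 → ℝ} (hpos : ∀ ω, 0 < φ ω) (hφ : IsLip φ) {f : E3 → ℝ}
    (hf : ContDiff ℝ 1 f) (hc : HasCompactSupport f) (v : E3) {ε : ℝ} (hε : 0 < ε) (hε1 : ε < 1) :
    ∫ x, fderiv ℝ f x v * cutoff ε (starGauge φ x) =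
      ∫ ω : S2, fderiv ℝ (starGauge φ) (ω : E3) v *
        (ε⁻¹ * ∫ r in (1 - ε) * φ ω..φ ω, r ^ 2 * f (r • (ω : E3))) ∂surf := by
  obtain ⟨C, hC⟩ := exists_lipschitzWith_starGauge hpos hφ
  obtain ⟨D, hD⟩ := hf.lipschitzWith_of_hasCompactSupport hc one_ne_zero
  have hχ : LipschitzWith ((ε⁻¹).nnabs * C) (fun x => cutoff ε (starGauge φ x)) :=
    lipschitzWith_cutoff.comp hC
  -- The cut-off is merely Lipschitz, so it enters through line derivatives, which exist almost
  -- everywhere.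
  have hibp := LipschitzWith.integral_lineDeriv_mul_eq (μ := volume) hχ hD hc v
  have e1 : ∫ x, fderiv ℝ f x v * cutoff ε (starGauge φ x) =
      - ∫ x, lineDeriv ℝ f x (-v) * cutoff ε (starGauge φ x) := by
    rw [← integral_neg]
    congr 1 with x
    rw [((hf.differentiable one_ne_zero) x).lineDeriv_eq_fderiv]
    simp
  have hint : Integrable
      (fun x => lineDeriv ℝ (fun x => cutoff ε (starGauge φ x)) x v * f x) := by
    have h1 := (hf.continuous.integrable_of_hasCompactSupport hc (μ := volume)).smul_of_top_left
      (hχ.memLp_lineDeriv (μ := volume) v)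
    exact h1.congr (Eventually.of_forall fun x => by simp [mul_comm])
  rw [e1, ← hibp, integral_polar hint, ← integral_neg]
  refine integral_congr_ae ?_
  filter_upwards [ae_differentiableAt_starGauge hpos hφ] with ω hω
  have hp := hpos ω
  have hl : (1 - ε) * φ ω ≤ φ ω := by nlinarith
  have h0 : 0 < (1 - ε) * φ ω := mul_pos (by linarith) hp
  rw [intervalIntegral.integral_of_le hl, integral_Ioc_eq_integral_Ioo, ← integral_const_mul,
    ← integral_const_mul, ← integral_indicator measurableSet_Ioi,
    ← integral_indicator measurableSet_Ioo, ← integral_neg]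
  refine integral_congr_ae ?_
  -- The two kinks of the cut-off meet each ray in one radius each. Elsewhere its derivative is -ε⁻¹
  -- times that of the gauge inside the shell, and 0 outside.
  have hn1 : ∀ᵐ r : ℝ, r ≠ φ ω := by simp [ae_iff]
  have hn2 : ∀ᵐ r : ℝ, r ≠ (1 - ε) * φ ω := by simp [ae_iff]
  filter_upwards [hn1, hn2] with r h1 h2
  by_cases hr : 0 < r
  swap
  · rw [Set.indicator_of_notMem (by simpa using hr), Set.indicator_of_notMem]
    · simp
    · intro h; exact hr (h0.trans h.1)
  rw [Set.indicator_of_mem (by simpa using hr)]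
  have hg := hasFDerivAt_starGauge_smul hω.hasFDerivAt hr
  have hs : starGauge φ (r • (ω : E3)) = r / φ ω := starGauge_smul_coe φ hr ω
  have hd := hasDerivAt_cutoff (s := starGauge φ (r • (ω : E3))) hε
    (by rw [hs, Ne, div_eq_one_iff_eq hp.ne']; exact h1)
    (by rw [hs, Ne, div_eq_iff hp.ne']; exact h2)
  have hcomp := (hd.comp_hasFDerivAt _ hg).hasLineDerivAt v
  have hld : lineDeriv ℝ (fun x => cutoff ε (starGauge φ x)) (r • (ω : E3)) v = _ :=
    hcomp.lineDeriv
  rw [hld]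
  by_cases hm : r ∈ Set.Ioo ((1 - ε) * φ ω) (φ ω)
  · have hm' : starGauge φ (r • (ω : E3)) ∈ Set.Ioo (1 - ε) 1 := by
      rw [hs]
      exact ⟨(lt_div_iff₀ hp).2 hm.1, (div_lt_one hp).2 hm.2⟩
    rw [Set.indicator_of_mem hm, Set.indicator_of_mem hm']
    simp
    ring
  · have hm' : starGauge φ (r • (ω : E3)) ∉ Set.Ioo (1 - ε) 1 := by
      rw [hs]
      intro h
      exact hm ⟨(lt_div_iff₀ hp).1 h.1, (div_lt_one hp).1 h.2⟩
    rw [Set.indicator_of_notMem hm, Set.indicator_of_notMem hm']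
    simp

lemma tendsto_cutoff (s : ℝ) :
    Tendsto (fun ε => cutoff ε s) (𝓝[>] 0) (𝓝 ((Set.Iio 1).indicator (fun _ => 1) s)) := by
  by_cases hs : s < 1
  · rw [Set.indicator_of_mem (by simpa using hs)]
    refine tendsto_const_nhds.congr' ?_
    filter_upwards [Ioo_mem_nhdsGT (sub_pos.2 hs)] with ε hε
    exact (cutoff_of_le hε.1 (by linarith [hε.2])).symm
  · rw [Set.indicator_of_notMem (by simpa using hs)]
    refine tendsto_const_nhds.congr' ?_
    filter_upwards [self_mem_nhdsWithin] with ε hε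
    exact (cutoff_of_one_le hε (not_lt.1 hs)).symm

/-- The limit is the derivative at ε = 0 of the integral over [(1 - ε)a, a]; the factor a appears
because this interval has length εa. -/
lemma tendsto_average_left {h : ℝ → ℝ} (hh : Continuous h) (a : ℝ) :
    Tendsto (fun ε => ε⁻¹ * ∫ r in (1 - ε) * a..a, h r) (𝓝[>] 0) (𝓝 (a * h a)) := by
  have h1 : HasDerivAt (fun s => ∫ r in s..a, h r) (-h a) ((1 - 0) * a) := by
    simpa using intervalIntegral.integral_hasDerivAt_left
      (hh.intervalIntegrable _ _) hh.aestronglyMeasurable.stronglyMeasurableAtFilter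
      (b := a) (a := a) hh.continuousAt
  have h2 : HasDerivAt (fun ε : ℝ => (1 - ε) * a) (-a) 0 := by
    simpa using ((hasDerivAt_id (0 : ℝ)).const_sub 1).mul_const a
  have h3 := (h1.comp (0 : ℝ) h2).tendsto_slope_zero_right
  simp at h3
  simpa [mul_comm] using h3

/-- The Gauss–Green formula for a star-shaped Lipschitz set, for one partial derivative. -/
lemma setIntegral_fderiv_starSet {φ : S2 → ℝ} (hpos : ∀ ω, 0 < φ ω) (hφ : IsLip φ) {f : E3 → ℝ}
    (hf : ContDiff ℝ 1 f) (hc : HasCompactSupport f) (v : E3) :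
    ∫ x in starSet φ, fderiv ℝ f x v =
      ∫ ω : S2, fderiv ℝ (starGauge φ) (ω : E3) v *
        (φ ω * (φ ω ^ 2 * f (φ ω • (ω : E3)))) ∂surf := by
  obtain ⟨C, hC⟩ := exists_lipschitzWith_starGauge hpos hφ
  obtain ⟨M, hM, hφM⟩ := exists_bound_of_continuous hφ.continuous
  obtain ⟨B, hB⟩ := hc.exists_bound_of_continuous hf.continuous
  have hmeas := measurableSet_starSet hφ.continuous.measurable
  have hdc : Continuous (fun x => fderiv ℝ f x v) :=
    (hf.continuous_fderiv one_ne_zero).clm_apply continuous_const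
  have hdi : Integrable (fun x => fderiv ℝ f x v) :=
    hdc.integrable_of_hasCompactSupport (hc.fderiv_apply ℝ v)
  have hcut : ∀ ε, Continuous (cutoff ε) := fun ε => lipschitzWith_cutoff.continuous
  have hl : Tendsto (fun ε => ∫ x, fderiv ℝ f x v * cutoff ε (starGauge φ x)) (𝓝[>] 0)
      (𝓝 (∫ x in starSet φ, fderiv ℝ f x v)) := by
    rw [← integral_indicator hmeas]
    refine tendsto_integral_filter_of_dominated_convergence (fun x => ‖fderiv ℝ f x v‖)
      (Eventually.of_forall fun ε =>
        (hdc.mul ((hcut ε).comp hC.continuous)).aestronglyMeasurable)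
      (Eventually.of_forall fun ε => Eventually.of_forall fun x => ?_) hdi.norm
      (Eventually.of_forall fun x => ?_)
    · rw [norm_mul, Real.norm_of_nonneg (cutoff_nonneg _ _)]
      exact mul_le_of_le_one_right (norm_nonneg _) (cutoff_le_one _ _)
    · convert (tendsto_cutoff (starGauge φ x)).const_mul (fderiv ℝ f x v) using 2
      by_cases hx : x ∈ starSet φ
      · have := (starGauge_lt_one_iff hpos x).2 hx
        simp [hx, this]
      · have := mt (starGauge_lt_one_iff hpos x).1 hx
        simp [hx, this]
  have hr : Tendsto (fun ε => ∫ ω : S2, fderiv ℝ (starGauge φ) (ω : E3) v *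
        (ε⁻¹ * ∫ r in (1 - ε) * φ ω..φ ω, r ^ 2 * f (r • (ω : E3))) ∂surf) (𝓝[>] 0)
      (𝓝 (∫ ω : S2, fderiv ℝ (starGauge φ) (ω : E3) v *
        (φ ω * (φ ω ^ 2 * f (φ ω • (ω : E3)))) ∂surf)) := by
    -- The shell has thickness εφ ≤ εM and the integrand there is at most M²B, which absorbs the
    -- factor ε⁻¹; the derivative of the gauge is bounded by its Lipschitz constant C times ‖v‖.
    refine tendsto_integral_filter_of_dominated_convergence
      (fun _ => C * ‖v‖ * (M * (M ^ 2 * B))) ?_ ?_ (integrable_const _)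
      (Eventually.of_forall fun ω => ?_)
    · refine Eventually.of_forall fun ε => ?_
      refine AEStronglyMeasurable.mul ?_ ?_
      · exact (((measurable_fderiv_apply_const ℝ (starGauge φ) v).comp
          measurable_subtype_coe)).aestronglyMeasurable
      · refine (Continuous.aestronglyMeasurable ?_).const_mul _
        have hcc : ∀ ω : S2, Continuous (fun r : ℝ => r ^ 2 * f (r • (ω : E3))) := fun ω => by
          have := hf.continuous
          fun_prop
        have e : (fun ω : S2 => ∫ r in (1 - ε) * φ ω..φ ω, r ^ 2 * f (r • (ω : E3))) =
            fun ω : S2 => (∫ r in 0..φ ω, r ^ 2 * f (r • (ω : E3))) -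
              ∫ r in 0..(1 - ε) * φ ω, r ^ 2 * f (r • (ω : E3)) := by
          funext ω
          rw [intervalIntegral.integral_interval_sub_left] <;>
            exact (hcc ω).intervalIntegrable _ _
        rw [e]
        exact (continuous_radialIntegral hf.continuous hφ.continuous).sub
          (continuous_radialIntegral hf.continuous (continuous_const.mul hφ.continuous))
    · filter_upwards [Ioo_mem_nhdsGT (zero_lt_one' ℝ)] with ε hε
      refine Eventually.of_forall fun ω => ?_
      have hp := hpos ω
      have hM' : φ ω ≤ M := (le_abs_self _).trans (hφM ω)
      have hB0 : 0 ≤ B := (norm_nonneg _).trans (hB 0)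
      have h0 : 0 < (1 - ε) * φ ω := mul_pos (by linarith [hε.2]) hp
      have hle : (1 - ε) * φ ω ≤ φ ω := by nlinarith [hε.1]
      have h1 : ‖∫ r in (1 - ε) * φ ω..φ ω, r ^ 2 * f (r • (ω : E3))‖ ≤
          (M ^ 2 * B) * |φ ω - (1 - ε) * φ ω| := by
        refine intervalIntegral.norm_integral_le_of_norm_le_const fun r hr => ?_
        rw [Set.uIoc_of_le hle] at hr
        have hr0 : 0 < r := h0.trans hr.1
        rw [norm_mul, norm_pow, Real.norm_of_nonneg hr0.le]
        gcongr
        · exact hr.2.trans hM'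
        · exact hB _
      have h2 : φ ω - (1 - ε) * φ ω = ε * φ ω := by ring
      rw [h2, abs_of_pos (mul_pos hε.1 hp)] at h1
      have h3 : ‖ε⁻¹ * ∫ r in (1 - ε) * φ ω..φ ω, r ^ 2 * f (r • (ω : E3))‖ ≤ M * (M ^ 2 * B) := by
        have hεp := hε.1
        rw [norm_mul, norm_inv, Real.norm_of_nonneg hεp.le, inv_mul_le_iff₀ hεp]
        calc _ ≤ _ := h1
          _ ≤ (M ^ 2 * B) * (ε * M) := by gcongr
          _ = _ := by ring
      rw [norm_mul]
      gcongr
      exact (ContinuousLinearMap.le_opNorm _ _).trans (by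
        gcongr
        exact norm_fderiv_le_of_lipschitz ℝ hC)
    · have := hf.continuous
      exact (tendsto_average_left (h := fun r => r ^ 2 * f (r • (ω : E3))) (by fun_prop)
        (φ ω)).const_mul _
  refine tendsto_nhds_unique hl (hr.congr' ?_)
  filter_upwards [Ioo_mem_nhdsGT (zero_lt_one' ℝ)] with ε hε
  exact (integral_fderiv_mul_cutoff hpos hφ hf hc v hε.1 hε.2).symm

/-- The outward normal of the star-shaped set at `φ(ω) ω`, scaled by the surface element. -/
def normalField (φ : S2 → ℝ) (ω : S2) : E3 := φ ω ^ 2 • (ω : E3) - φ ω • sphGrad φ ω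

/-- Pythagoras: the spherical gradient is orthogonal to ω. -/
lemma norm_normalField {φ : S2 → ℝ} (hpos : ∀ ω, 0 < φ ω) (ω : S2) :
    ‖normalField φ ω‖ = φ ω * slope φ ω := by
  have hp := hpos ω
  have h1 : inner ℝ (ω : E3) (sphGrad φ ω) = 0 := by
    rw [real_inner_comm]; exact inner_sphGrad_coe φ ω
  have h2 : ‖normalField φ ω‖ ^ 2 = (φ ω * slope φ ω) ^ 2 := by
    rw [normalField, norm_sub_sq_real, inner_smul_left, inner_smul_right, h1, norm_smul, norm_smul,
      norm_coe, mul_pow (φ ω), slope, Real.sq_sqrt (by positivity)]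
    simp [abs_of_pos hp]
    ring
  have h3 : 0 ≤ φ ω * slope φ ω := mul_nonneg hp.le (Real.sqrt_nonneg _)
  exact (sq_eq_sq₀ (norm_nonneg _) h3).1 h2

lemma measurable_normalField {φ : S2 → ℝ} (hφ : IsLip φ) : Measurable (normalField φ) := by
  have h1 := hφ.continuous.measurable
  have h2 := measurable_sphGrad φ
  unfold normalField
  fun_prop

lemma exists_norm_normalField_le {φ : S2 → ℝ} (hφ : IsLip φ) :
    ∃ B, 0 < B ∧ ∀ ω, ‖normalField φ ω‖ ≤ B := by
  obtain ⟨M, hM, hφM⟩ := exists_bound_of_continuous hφ.continuous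
  obtain ⟨C, hC, hgC⟩ := hφ.norm_sphGrad_le
  refine ⟨M ^ 2 + M * C, by positivity, fun ω => ?_⟩
  refine (norm_sub_le _ _).trans ?_
  rw [norm_smul, norm_smul, norm_coe, norm_pow, mul_one]
  gcongr
  · exact hφM ω
  · exact hφM ω
  · exact hgC ω

lemma divergence_eq_sum {X : E3 → E3} (hX : Differentiable ℝ X) (x : E3) :
    divergence X x = ∑ i : Fin 3, fderiv ℝ (fun y => X y i) x (EuclideanSpace.single i 1) := by
  refine Finset.sum_congr rfl fun i _ => ?_
  have h := ((EuclideanSpace.proj i : E3 →L[ℝ] ℝ).hasFDerivAt).comp x (hX x).hasFDerivAt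
  have h' : HasFDerivAt (fun y => X y i) _ x := h
  rw [h'.fderiv]
  simp

/-- The Gauss–Green formula for a star-shaped Lipschitz set. -/
lemma setIntegral_divergence_starSet {φ : S2 → ℝ} (hpos : ∀ ω, 0 < φ ω) (hφ : IsLip φ)
    {X : E3 → E3} (hX : ContDiff ℝ 1 X) (hc : HasCompactSupport X) :
    ∫ x in starSet φ, divergence X x =
      ∫ ω : S2, inner ℝ (X (φ ω • (ω : E3))) (normalField φ ω) ∂surf := by
  obtain ⟨C, hC⟩ := exists_lipschitzWith_starGauge hpos hφ
  have hXi : ∀ i : Fin 3, ContDiff ℝ 1 (fun y => X y i) := fun i =>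
    (EuclideanSpace.proj i : E3 →L[ℝ] ℝ).contDiff.comp hX
  have hci : ∀ i : Fin 3, HasCompactSupport (fun y => X y i) := fun i =>
    hc.comp_left (g := fun y : E3 => y i) rfl
  have hint : ∀ i : Fin 3, Integrable (fun ω : S2 =>
      fderiv ℝ (starGauge φ) (ω : E3) (EuclideanSpace.single i 1) *
        (φ ω * (φ ω ^ 2 * X (φ ω • (ω : E3)) i))) surf := by
    intro i
    have hcont : Continuous fun ω : S2 => φ ω * (φ ω ^ 2 * X (φ ω • (ω : E3)) i) := by
      have h1 := hφ.continuous
      have h2 := (hXi i).continuous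
      have h3 : Continuous fun ω : S2 => X (φ ω • (ω : E3)) i :=
        h2.comp (by fun_prop : Continuous fun ω : S2 => φ ω • (ω : E3))
      fun_prop
    obtain ⟨M, hM, hb⟩ := exists_bound_of_continuous hcont
    refine Integrable.of_bound (C := C * ‖(EuclideanSpace.single i 1 : E3)‖ * M)
      (((measurable_fderiv_apply_const ℝ (starGauge φ) _).comp
          measurable_subtype_coe).aestronglyMeasurable.mul hcont.aestronglyMeasurable)
      (Eventually.of_forall fun ω => ?_)
    rw [norm_mul]
    gcongr
    · exact (ContinuousLinearMap.le_opNorm _ _).trans (by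
        gcongr
        exact norm_fderiv_le_of_lipschitz ℝ hC)
    · exact hb ω
  simp_rw [divergence_eq_sum (hX.differentiable one_ne_zero)]
  rw [integral_finsetSum]
  · simp_rw [setIntegral_fderiv_starSet hpos hφ (hXi _) (hci _)]
    rw [← integral_finsetSum _ fun i _ => hint i]
    refine integral_congr_ae ?_
    filter_upwards [hφ.ae_differentiableAt] with ω hω
    have hp := (hpos ω).ne'
    rw [(hasFDerivAt_starGauge hpos hω).fderiv, PiLp.inner_apply]
    refine Finset.sum_congr rfl fun i _ => ?_
    simp [normalField, InnerProductSpace.toDual_apply_apply, EuclideanSpace.inner_single_right]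
    field_simp
  · intro i _
    refine Integrable.integrableOn (Continuous.integrable_of_hasCompactSupport
      (((hXi i).continuous_fderiv one_ne_zero).clm_apply continuous_const)
      ((hci i).fderiv_apply ℝ _))

/-! ### The perimeter by duality -/

/-- Rescaling vectors of norm larger than one at most doubles the
distance to a vector of the unit ball. -/
lemma norm_sub_retract_le {a b : E3} (ha : ‖a‖ ≤ 1) :
    ‖a - (max 1 ‖b‖)⁻¹ • b‖ ≤ 2 * ‖a - b‖ := by
  rcases le_total ‖b‖ 1 with hb | hb
  · rw [max_eq_left hb]
    simp
    linarith [norm_nonneg (a - b)]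
  · rw [max_eq_right hb]
    have hb0 : 0 < ‖b‖ := by linarith
    have h1 : ‖b - ‖b‖⁻¹ • b‖ = ‖b‖ - 1 := by
      have : b - ‖b‖⁻¹ • b = (1 - ‖b‖⁻¹) • b := by rw [sub_smul, one_smul]
      rw [this, norm_smul, Real.norm_of_nonneg (sub_nonneg.2 (inv_le_one_of_one_le₀ hb)), sub_mul,
        inv_mul_cancel₀ hb0.ne', one_mul]
    have h2 : ‖b‖ - ‖a‖ ≤ ‖a - b‖ := by rw [norm_sub_rev]; exact norm_sub_norm_le b a
    calc ‖a - ‖b‖⁻¹ • b‖ = ‖(a - b) + (b - ‖b‖⁻¹ • b)‖ := by congr 1; abel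
      _ ≤ ‖a - b‖ + ‖b - ‖b‖⁻¹ • b‖ := norm_add_le _ _
      _ ≤ 2 * ‖a - b‖ := by rw [h1]; linarith

/-- A measurable field of vectors in the unit ball is approximated in `L¹` of a finite measure by
smooth compactly supported fields of vectors in the unit ball. -/
lemma exists_contDiff_integral_norm_sub_le (m : Measure E3) [IsFiniteMeasure m] {ν : E3 → E3}
    (hν : Measurable ν) (h1 : ∀ x, ‖ν x‖ ≤ 1) {ε : ℝ} (hε : 0 < ε) :
    ∃ X : E3 → E3, ContDiff ℝ 1 X ∧ HasCompactSupport X ∧ (∀ x, ‖X x‖ ≤ 1) ∧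
      ∫ x, ‖ν x - X x‖ ∂m ≤ ε := by
  have hνi : Integrable ν m := Integrable.of_bound (C := 1) hν.aestronglyMeasurable
    (Eventually.of_forall h1)
  -- The error will be 2δ from the L¹ approximation, doubled by the retraction to the unit ball,
  -- plus 2δ times the total mass from uniform smoothing and from dividing by 1 + δ, which restores
  -- norm at most 1.
  set δ : ℝ := ε / (2 + 2 * m.real Set.univ) with hδdef
  have hδ : 0 < δ := by positivity
  obtain ⟨g, hgc, hg, hgcont, hgi⟩ := hνi.exists_hasCompactSupport_integral_sub_le hδ
  have hcont : Continuous fun x => (max 1 ‖g x‖)⁻¹ • g x := by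
    have h : Continuous fun x => (max 1 ‖g x‖)⁻¹ :=
      Continuous.inv₀ (by fun_prop) fun x => (lt_max_of_lt_left one_pos).ne'
    exact h.smul hgcont
  have hle : ∀ x, ‖(max 1 ‖g x‖)⁻¹ • g x‖ ≤ 1 := fun x => by
    have : 0 < max 1 ‖g x‖ := lt_max_of_lt_left one_pos
    rw [norm_smul, norm_inv, Real.norm_of_nonneg this.le, inv_mul_le_iff₀ this, mul_one]
    exact le_max_right _ _
  obtain ⟨h, hh, hhd, hhs⟩ := hcont.exists_contDiff_approx 1 (ε := fun _ => δ) continuous_const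
    fun _ => hδ
  have hnorm : ∀ x, ‖h x‖ ≤ 1 + δ := fun x => by
    have := (hhd x).le
    rw [dist_eq_norm] at this
    calc ‖h x‖ = ‖(h x - (max 1 ‖g x‖)⁻¹ • g x) + (max 1 ‖g x‖)⁻¹ • g x‖ := by congr 1; abel
      _ ≤ δ + 1 := (norm_add_le _ _).trans (add_le_add this (hle x))
      _ = 1 + δ := add_comm _ _
  have hsupp : HasCompactSupport h := by
    refine hgc.mono (hhs.trans fun x hx => ?_)
    simp only [Function.mem_support] at hx ⊢
    exact fun h0 => hx (by rw [h0, smul_zero])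
  have hpt : ∀ x, ‖ν x - (1 + δ)⁻¹ • h x‖ ≤ 2 * ‖ν x - g x‖ + 2 * δ := fun x => by
    have e1 := norm_sub_retract_le (b := g x) (h1 x)
    have e2 := (hhd x).le
    rw [dist_comm, dist_eq_norm] at e2
    have e3 : ‖h x - (1 + δ)⁻¹ • h x‖ ≤ δ := by
      have : h x - (1 + δ)⁻¹ • h x = (δ * (1 + δ)⁻¹) • h x := by
        have h4 : δ * (1 + δ)⁻¹ = 1 - (1 + δ)⁻¹ := by field_simp; ring
        rw [h4, sub_smul, one_smul]
      rw [this, norm_smul, Real.norm_of_nonneg (by positivity)]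
      calc δ * (1 + δ)⁻¹ * ‖h x‖ ≤ δ * (1 + δ)⁻¹ * (1 + δ) := by gcongr; exact hnorm x
        _ = δ := by field_simp
    calc ‖ν x - (1 + δ)⁻¹ • h x‖ = ‖(ν x - (max 1 ‖g x‖)⁻¹ • g x) +
          ((max 1 ‖g x‖)⁻¹ • g x - h x) + (h x - (1 + δ)⁻¹ • h x)‖ := by congr 1; abel
      _ ≤ 2 * ‖ν x - g x‖ + δ + δ := norm_add₃_le.trans (by gcongr)
      _ = _ := by ring
  have hXd : ContDiff ℝ 1 fun x => (1 + δ)⁻¹ • h x := 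
    (contDiff_const_smul (1 + δ)⁻¹).comp hh
  have hXs : HasCompactSupport fun x => (1 + δ)⁻¹ • h x :=
    hsupp.comp_left (g := fun y : E3 => (1 + δ)⁻¹ • y) (smul_zero _)
  refine ⟨fun x => (1 + δ)⁻¹ • h x, hXd, hXs, fun x => ?_, ?_⟩
  · rw [norm_smul, Real.norm_of_nonneg (by positivity), inv_mul_le_iff₀ (by positivity), mul_one]
    exact hnorm x
  · have hi : Integrable (fun x => 2 * ‖ν x - g x‖) m := (hνi.sub hgi).norm.const_mul 2
    calc ∫ x, ‖ν x - (1 + δ)⁻¹ • h x‖ ∂m ≤ ∫ x, (2 * ‖ν x - g x‖ + 2 * δ) ∂m := by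
          refine integral_mono_of_nonneg (Eventually.of_forall fun _ => norm_nonneg _)
            (hi.add (integrable_const _)) (Eventually.of_forall hpt)
      _ = 2 * ∫ x, ‖ν x - g x‖ ∂m + m.real Set.univ * (2 * δ) := by
          rw [integral_add hi (integrable_const _), integral_const_mul, integral_const, smul_eq_mul]
      _ ≤ 2 * δ + m.real Set.univ * (2 * δ) := by gcongr
      _ = δ * (2 + 2 * m.real Set.univ) := by ring
      _ = ε := by rw [hδdef]; field_simp

lemma integrable_norm_normalField {φ : S2 → ℝ} (hφ : IsLip φ) :
    Integrable (fun ω => ‖normalField φ ω‖) surf := by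
  obtain ⟨B, hB, hb⟩ := exists_norm_normalField_le hφ
  exact Integrable.of_bound (C := B) (measurable_normalField hφ).norm.aestronglyMeasurable
    (Eventually.of_forall fun ω => by simpa using hb ω)

/-- The perimeter of a star-shaped Lipschitz set. -/
theorem perimeter_starSet {φ : S2 → ℝ} (hpos : ∀ ω, 0 < φ ω) (hφ : IsLip φ) :
    perimeter (starSet φ) = ENNReal.ofReal (∫ ω, φ ω * slope φ ω ∂surf) := by
  obtain ⟨B, hB, hb⟩ := exists_norm_normalField_le hφ
  simp_rw [← norm_normalField hpos]
  have hcont : Continuous fun ω : S2 => φ ω • (ω : E3) := hφ.continuous.smul continuous_subtype_val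
  have hint : ∀ {X : E3 → E3}, Measurable X → (∀ x, ‖X x‖ ≤ 1) →
      Integrable (fun ω : S2 => inner ℝ (X (φ ω • (ω : E3))) (normalField φ ω)) surf := by
    intro X hX h1
    refine (integrable_norm_normalField hφ).mono
      ((hX.comp hcont.measurable).inner (measurable_normalField hφ)).aestronglyMeasurable
      (Eventually.of_forall fun ω => ?_)
    rw [norm_norm]
    exact (norm_inner_le_norm _ _).trans (mul_le_of_le_one_left (norm_nonneg _) (h1 _))
  apply le_antisymm
  · refine iSup₂_le fun X hX => ENNReal.ofReal_le_ofReal ?_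
    rw [setIntegral_divergence_starSet hpos hφ hX.1 hX.2.1]
    refine integral_mono (hint hX.1.continuous.measurable hX.2.2) (integrable_norm_normalField hφ)
      fun ω => ?_
    exact (real_inner_le_norm _ _).trans (mul_le_of_le_one_left (norm_nonneg _) (hX.2.2 _))
  · refine ENNReal.le_of_forall_pos_le_add fun ε hε _ => ?_
    have hε' : 0 < (ε : ℝ) / B := by positivity
    -- The unit normal, extended constantly along rays, is the optimal field but only measurable. It
    -- is approximated in L¹ of the image of `surf` on the boundary; the tolerance ε/B compensates
    -- the weight ‖normalField‖ ≤ B.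
    set ν : E3 → E3 := fun x => ‖normalField φ (dir x)‖⁻¹ • normalField φ (dir x) with hνdef
    have hνm : Measurable ν := by
      have := (measurable_normalField hφ).comp measurable_dir
      exact this.norm.inv.smul this
    have hν1 : ∀ x, ‖ν x‖ ≤ 1 := fun x => by
      rw [hνdef, norm_smul, norm_inv, norm_norm]
      exact inv_mul_le_one
    obtain ⟨X, hX, hXc, hX1, hXi⟩ := exists_contDiff_integral_norm_sub_le
      (surf.map fun ω : S2 => φ ω • (ω : E3)) hνm hν1 hε'
    have hsub : Measurable fun x => ‖ν x - X x‖ := (hνm.sub hX.continuous.measurable).norm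
    rw [integral_map hcont.aemeasurable hsub.aestronglyMeasurable] at hXi
    have hle : ∫ ω, ‖normalField φ ω‖ ∂surf ≤ (∫ x in starSet φ, divergence X x) + ε := by
      rw [setIntegral_divergence_starSet hpos hφ hX hXc]
      have hi1 := hint hX.continuous.measurable hX1
      have hi2 : Integrable (fun ω : S2 => ‖ν (φ ω • (ω : E3)) - X (φ ω • (ω : E3))‖) surf := by
        refine Integrable.of_bound (C := 2) (hsub.comp hcont.measurable).aestronglyMeasurable
          (Eventually.of_forall fun ω => ?_)
        rw [norm_norm]
        exact (norm_sub_le _ _).trans (by linarith [hν1 (φ ω • (ω : E3)), hX1 (φ ω • (ω : E3))])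
      calc ∫ ω, ‖normalField φ ω‖ ∂surf
          ≤ ∫ ω : S2, (inner ℝ (X (φ ω • (ω : E3))) (normalField φ ω) +
              ‖ν (φ ω • (ω : E3)) - X (φ ω • (ω : E3))‖ * B) ∂surf := by
            refine integral_mono (integrable_norm_normalField hφ) (hi1.add (hi2.mul_const B))
              fun ω => ?_
            have e1 : inner ℝ (ν (φ ω • (ω : E3))) (normalField φ ω) = ‖normalField φ ω‖ := by
              rw [hνdef]
              simp only [dir_smul_coe (hpos ω), inner_smul_left, real_inner_self_eq_norm_sq]
              by_cases h0 : ‖normalField φ ω‖ = 0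
              · simp [h0]
              · simp only [conj_trivial]; field_simp
            have e2 : inner ℝ (ν (φ ω • (ω : E3)) - X (φ ω • (ω : E3))) (normalField φ ω) ≤
                ‖ν (φ ω • (ω : E3)) - X (φ ω • (ω : E3))‖ * B :=
              (real_inner_le_norm _ _).trans (by gcongr; exact hb ω)
            rw [inner_sub_left, e1] at e2
            simp only
            linarith
        _ = _ := by rw [integral_add hi1 (hi2.mul_const B), integral_mul_const]
        _ ≤ _ := by
            gcongr
            calc _ ≤ (ε : ℝ) / B * B := by gcongr
              _ = ε := by field_simp
    calc ENNReal.ofReal (∫ ω, ‖normalField φ ω‖ ∂surf)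
        ≤ ENNReal.ofReal ((∫ x in starSet φ, divergence X x) + ε) := ENNReal.ofReal_le_ofReal hle
      _ ≤ ENNReal.ofReal (∫ x in starSet φ, divergence X x) + ENNReal.ofReal ε :=
          ENNReal.ofReal_add_le
      _ ≤ _ := by
          rw [ENNReal.ofReal_coe_nnreal]
          gcongr
          exact le_iSup₂_of_le X ⟨hX, hXc, hX1⟩ le_rfl

/-! ### The Newtonian potential -/

lemma starSet_const {δ : ℝ} : starSet (fun _ => δ) = ball (0 : E3) δ := by
  ext x; simp [starSet]

lemma integrableOn_one_div_norm_ball (δ : ℝ) : IntegrableOn (fun z : E3 => 1 / ‖z‖) (ball 0 δ) := by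
  rw [integrableOn_fun_norm_addHaar volume (f := fun r => 1 / r)]
  have h : IntegrableOn (fun y : ℝ => y) (Set.Ioo 0 δ) :=
    (continuous_id.integrableOn_Icc (a := 0) (b := δ)).mono_set Set.Ioo_subset_Icc_self
  refine h.congr_fun (fun y hy => ?_) measurableSet_Ioo
  have : y ≠ 0 := hy.1.ne'
  simp
  field_simp

lemma setIntegral_one_div_norm_ball {δ : ℝ} (hδ : 0 < δ) :
    ∫ z in ball (0 : E3) δ, 1 / ‖z‖ = surf.real Set.univ / 2 * δ ^ 2 := by
  have hi := integrableOn_one_div_norm_ball δ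
  rw [← starSet_const] at hi ⊢
  rw [setIntegral_starSet measurable_const (fun _ => hδ.le) hi]
  have : ∀ ω : S2, ∫ r in 0..δ, r ^ 2 * (1 / ‖r • (ω : E3)‖) = δ ^ 2 / 2 := by
    intro ω
    have : ∫ r in 0..δ, r ^ 2 * (1 / ‖r • (ω : E3)‖) = ∫ r in 0..δ, r := by
      refine intervalIntegral.integral_congr fun r hr => ?_
      rw [Set.uIcc_of_le hδ.le] at hr
      simp only [norm_smul_coe hr.1]
      rcases eq_or_ne r 0 with h | h
      · simp [h]
      · field_simp
    rw [this]
    simp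
  simp_rw [this]
  simp
  ring

/-- The Newtonian potential of a set. -/
def newtonPotential (A : Set E3) (x : E3) : ℝ := ∫ y in A, 1 / ‖x - y‖

lemma newtonPotential_nonneg (A : Set E3) (x : E3) : 0 ≤ newtonPotential A x :=
  integral_nonneg fun _ => by positivity

/-- The singular part of the Newtonian kernel. -/
def kernelNear (δ : ℝ) : E3 → ℝ := (ball 0 δ).indicator fun z => 1 / ‖z‖

lemma kernelNear_nonneg (δ : ℝ) (z : E3) : 0 ≤ kernelNear δ z :=
  Set.indicator_nonneg (fun _ _ => by positivity) _

lemma integrable_kernelNear (δ : ℝ) : Integrable (kernelNear δ) :=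
  (integrable_indicator_iff measurableSet_ball).2 (integrableOn_one_div_norm_ball δ)

lemma setIntegral_kernelNear_le (A : Set E3) (x : E3) {δ : ℝ} (hδ : 0 < δ) :
    ∫ y in A, kernelNear δ (x - y) ≤ surf.real Set.univ / 2 * δ ^ 2 := by
  calc ∫ y in A, kernelNear δ (x - y) ≤ ∫ y, kernelNear δ (x - y) :=
        setIntegral_le_integral ((integrable_kernelNear δ).comp_sub_left x)
          (Eventually.of_forall fun _ => kernelNear_nonneg _ _)
    _ = _ := by
        rw [integral_sub_left_eq_self (kernelNear δ), kernelNear,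
          integral_indicator measurableSet_ball, setIntegral_one_div_norm_ball hδ]

lemma one_div_norm_le {δ : ℝ} (hδ : 0 < δ) (z : E3) : 1 / ‖z‖ ≤ kernelNear δ z + 1 / δ := by
  by_cases hz : z ∈ ball (0 : E3) δ
  · rw [kernelNear, Set.indicator_of_mem hz]
    have : 0 < 1 / δ := by positivity
    linarith
  · rw [kernelNear, Set.indicator_of_notMem hz, zero_add]
    simp at hz
    gcongr

lemma measurable_kernel : Measurable fun p : E3 × E3 => 1 / ‖p.1 - p.2‖ := by fun_prop

lemma integrableOn_kernel {A : Set E3} (hA : volume A ≠ ∞) (x : E3) :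
    IntegrableOn (fun y => 1 / ‖x - y‖) A := by
  have h : IntegrableOn (fun y => kernelNear 1 (x - y) + 1 / 1) A :=
    ((integrable_kernelNear 1).comp_sub_left x).integrableOn.add
      (integrableOn_const hA)
  refine h.mono' (Measurable.aestronglyMeasurable (by fun_prop)) (Eventually.of_forall fun y => ?_)
  rw [Real.norm_of_nonneg (by positivity)]
  exact one_div_norm_le one_pos (x - y)

/-- Splitting the kernel at distance δ gives a near part bounded by the integral over a full ball
and a far part at most 1/δ. The bound is uniform in x, and free choice of δ makes it small for sets
of small volume. -/
lemma newtonPotential_le {A : Set E3} (hA : volume A ≠ ∞) (x : E3) {δ : ℝ} (hδ : 0 < δ) :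
    newtonPotential A x ≤ surf.real Set.univ / 2 * δ ^ 2 + volume.real A / δ := by
  have h1 : IntegrableOn (fun y => kernelNear δ (x - y)) A :=
    ((integrable_kernelNear δ).comp_sub_left x).integrableOn
  have h2 : IntegrableOn (fun _ : E3 => 1 / δ) A := integrableOn_const hA
  calc newtonPotential A x ≤ ∫ y in A, (kernelNear δ (x - y) + 1 / δ) :=
        integral_mono (integrableOn_kernel hA x) (h1.add h2) fun y => one_div_norm_le hδ (x - y)
    _ = (∫ y in A, kernelNear δ (x - y)) + volume.real A / δ := by
        rw [integral_add h1 h2, setIntegral_const, smul_eq_mul, mul_one_div]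
    _ ≤ _ := by gcongr; exact setIntegral_kernelNear_le A x hδ

/-- The truncated kernels 1/max(|z|, δ) are bounded and continuous, hence so are their potentials.
They differ from the true potential by at most the near part, of order δ² uniformly in x, so the
convergence is uniform. -/
lemma continuous_newtonPotential {A : Set E3} (hA : volume A ≠ ∞) :
    Continuous (newtonPotential A) := by
  have : IsFiniteMeasure (volume.restrict A) := ⟨by simpa using hA.lt_top⟩
  have hreg : ∀ δ : ℝ, 0 < δ → ∀ z : E3, ‖1 / max ‖z‖ δ‖ ≤ 1 / δ := fun δ hδ z => by
    rw [Real.norm_of_nonneg (by positivity)]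
    gcongr
    exact le_max_right _ _
  have hcz : ∀ δ : ℝ, 0 < δ → Continuous fun z : E3 => 1 / max ‖z‖ δ := fun δ hδ =>
    continuous_const.div (by fun_prop) fun z => (lt_max_of_lt_right hδ).ne'
  have hi : ∀ δ : ℝ, 0 < δ → ∀ x : E3, IntegrableOn (fun y => 1 / max ‖x - y‖ δ) A :=
    fun δ hδ x => Integrable.of_bound (C := 1 / δ)
      ((hcz δ hδ).comp (continuous_const.sub continuous_id)).aestronglyMeasurable
      (Eventually.of_forall fun y => hreg δ hδ (x - y))
  have hc : ∀ δ : ℝ, 0 < δ → Continuous fun x : E3 => ∫ y in A, 1 / max ‖x - y‖ δ := by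
    intro δ hδ
    refine continuous_of_dominated (bound := fun _ => 1 / δ) (fun x => (hi δ hδ x).1)
      (fun x => Eventually.of_forall fun y => hreg δ hδ (x - y)) (integrable_const _)
      (Eventually.of_forall fun y => (hcz δ hδ).comp (continuous_id.sub continuous_const))
  have hclose : ∀ δ : ℝ, 0 < δ → ∀ x : E3,
      |newtonPotential A x - ∫ y in A, 1 / max ‖x - y‖ δ| ≤ surf.real Set.univ / 2 * δ ^ 2 := by
    intro δ hδ x
    rw [newtonPotential, ← integral_sub (integrableOn_kernel hA x) (hi δ hδ x), ← Real.norm_eq_abs]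
    refine (norm_integral_le_of_norm_le
      (((integrable_kernelNear δ).comp_sub_left x).integrableOn (s := A))
      ?_).trans (setIntegral_kernelNear_le A x hδ)
    -- At y = x the convention 1/0 = 0 puts the kernel below its truncation, and the bound fails
    -- there.
    have hne : ∀ᵐ y : E3, y ≠ x := by simp [ae_iff]
    filter_upwards [ae_restrict_of_ae hne] with y hy
    by_cases hz : x - y ∈ ball (0 : E3) δ
    · rw [kernelNear, Set.indicator_of_mem hz]
      have hz' : ‖x - y‖ < δ := by simpa using hz
      have hn : 0 < ‖x - y‖ := norm_pos_iff.2 (sub_ne_zero.2 hy.symm)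
      rw [max_eq_right hz'.le, Real.norm_of_nonneg (sub_nonneg.2 (by gcongr))]
      have : 0 < 1 / δ := by positivity
      linarith
    · rw [kernelNear, Set.indicator_of_notMem hz]
      simp at hz
      rw [max_eq_left hz, sub_self, norm_zero]
  refine TendstoUniformly.continuous (F := fun δ x => ∫ y in A, 1 / max ‖x - y‖ δ) (p := 𝓝[>] (0 : ℝ))
    ?_ (Eventually.frequently (eventually_mem_nhdsWithin.mono fun δ hδ => hc δ hδ))
  rw [Metric.tendstoUniformly_iff]
  intro ε hε
  have ht : Tendsto (fun δ : ℝ => surf.real Set.univ / 2 * δ ^ 2) (𝓝[>] 0) (𝓝 0) := by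
    have : Continuous fun δ : ℝ => surf.real Set.univ / 2 * δ ^ 2 := by fun_prop
    simpa using (this.tendsto 0).mono_left nhdsWithin_le_nhds
  filter_upwards [ht.eventually_lt_const hε, self_mem_nhdsWithin] with δ h1 h2 x
  exact (hclose δ h2 x).trans_lt h1

lemma newtonPotential_abs_le {A : Set E3} (hA : volume A ≠ ∞) (x : E3) :
    |newtonPotential A x| ≤ surf.real Set.univ / 2 + volume.real A := by
  rw [abs_of_nonneg (newtonPotential_nonneg A x)]
  simpa using newtonPotential_le hA x one_pos

lemma integrableOn_newtonPotential {A B : Set E3} (hA : volume A ≠ ∞) (hB : volume B ≠ ∞) :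
    IntegrableOn (newtonPotential A) B := by
  have : IsFiniteMeasure (volume.restrict B) := ⟨by simpa using hB.lt_top⟩
  exact Integrable.of_bound (continuous_newtonPotential hA).aestronglyMeasurable _
    (Eventually.of_forall (newtonPotential_abs_le hA))

/-! ### The Coulomb energy and its expansion -/

lemma coulomb_eq {A : Set E3} (hA : volume A ≠ ∞) :
    coulomb A = ENNReal.ofReal (2⁻¹ * ∫ x in A, newtonPotential A x) := by
  have h1 : ∀ x, ∫⁻ y in A, ENNReal.ofReal (1 / ‖x - y‖) = ENNReal.ofReal (newtonPotential A x) :=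
    fun x => (ofReal_integral_eq_lintegral_ofReal (integrableOn_kernel hA x)
      (Eventually.of_forall fun y => by positivity)).symm
  simp_rw [coulomb, h1]
  rw [← ofReal_integral_eq_lintegral_ofReal (integrableOn_newtonPotential hA hA)
    (Eventually.of_forall fun x => newtonPotential_nonneg A x), ENNReal.ofReal_mul (by norm_num)]
  congr 1
  rw [ENNReal.ofReal_inv_of_pos (by norm_num)]
  simp

lemma coulomb_toReal {A : Set E3} (hA : volume A ≠ ∞) :
    (coulomb A).toReal = 2⁻¹ * ∫ x in A, newtonPotential A x := by
  rw [coulomb_eq hA, ENNReal.toReal_ofReal]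
  exact mul_nonneg (by norm_num) (integral_nonneg fun x => newtonPotential_nonneg A x)

lemma setIntegral_newtonPotential_comm {A B : Set E3} (hA : volume A ≠ ∞) (hB : volume B ≠ ∞) :
    ∫ x in A, newtonPotential B x = ∫ x in B, newtonPotential A x := by
  have hi : Integrable (Function.uncurry fun x y : E3 => 1 / ‖x - y‖)
      ((volume.restrict A).prod (volume.restrict B)) := by
    have hm : AEStronglyMeasurable (Function.uncurry fun x y : E3 => 1 / ‖x - y‖)
      ((volume.restrict A).prod (volume.restrict B)) := measurable_kernel.aestronglyMeasurable
    rw [integrable_prod_iff hm]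
    refine ⟨Eventually.of_forall fun x => integrableOn_kernel hB x, ?_⟩
    refine (integrableOn_newtonPotential hB hA).congr (Eventually.of_forall fun x => ?_)
    simp [newtonPotential]
  have := integral_integral_swap hi
  simp only [newtonPotential]
  rw [this]
  simp_rw [norm_sub_rev]

open scoped symmDiff in
lemma abs_setIntegral_sub_le {A B : Set E3} (hA : MeasurableSet A) (hB : MeasurableSet B)
    {h : E3 → ℝ} (hhA : IntegrableOn h A) (hhB : IntegrableOn h B) :
    |(∫ x in B, h x) - ∫ x in A, h x| ≤ ∫ x in A ∆ B, |h x| := by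
  have e1 := integral_inter_add_sdiff hB hhA
  have e2 := integral_inter_add_sdiff hA hhB
  rw [Set.inter_comm] at e2
  have e3 : (∫ x in B, h x) - ∫ x in A, h x = (∫ x in B \ A, h x) - ∫ x in A \ B, h x := by
    linarith
  have hi1 : IntegrableOn (fun x => |h x|) (A \ B) := (hhA.mono_set Set.sdiff_subset).abs
  have hi2 : IntegrableOn (fun x => |h x|) (B \ A) := (hhB.mono_set Set.sdiff_subset).abs
  have e4 : ∫ x in A ∆ B, |h x| = (∫ x in A \ B, |h x|) + ∫ x in B \ A, |h x| := by
    rw [Set.symmDiff_def]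
    exact setIntegral_union disjoint_sdiff_sdiff (hB.diff hA) hi1 hi2
  rw [e3, e4]
  refine (abs_sub _ _).trans ?_
  rw [add_comm]
  exact add_le_add abs_integral_le_integral_abs abs_integral_le_integral_abs

open scoped symmDiff in
/-- The second-order expansion of the Coulomb energy. -/
lemma abs_coulomb_sub_le {A B : Set E3} (hA : MeasurableSet A) (hB : MeasurableSet B)
    (hA' : volume A ≠ ∞) (hB' : volume B ≠ ∞) {δ : ℝ} (hδ : 0 < δ) :
    |(coulomb B).toReal - (coulomb A).toReal -
        ((∫ x in B, newtonPotential A x) - ∫ x in A, newtonPotential A x)| ≤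
      volume.real (A ∆ B) * (surf.real Set.univ / 2 * δ ^ 2 + volume.real (A ∆ B) / δ) := by
  have hAB : volume (A ∆ B) ≠ ∞ :=
    ((measure_mono symmDiff_le_sup).trans_lt (measure_union_lt_top hA'.lt_top hB'.lt_top)).ne
  set h : E3 → ℝ := fun x => newtonPotential B x - newtonPotential A x with hdef
  have hiA : IntegrableOn h A :=
    (integrableOn_newtonPotential hB' hA').sub (integrableOn_newtonPotential hA' hA')
  have hiB : IntegrableOn h B :=
    (integrableOn_newtonPotential hB' hB').sub (integrableOn_newtonPotential hA' hB')
  -- Symmetry of the kernel identifies the two mixed terms, leaving half the quadratic form of 1_B -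
  -- 1_A.
  have e : (coulomb B).toReal - (coulomb A).toReal -
        ((∫ x in B, newtonPotential A x) - ∫ x in A, newtonPotential A x) =
      2⁻¹ * ((∫ x in B, h x) - ∫ x in A, h x) := by
    rw [hdef, integral_sub (integrableOn_newtonPotential hB' hB')
      (integrableOn_newtonPotential hA' hB'), integral_sub (integrableOn_newtonPotential hB' hA')
      (integrableOn_newtonPotential hA' hA'), coulomb_toReal hA', coulomb_toReal hB',
      setIntegral_newtonPotential_comm hA' hB']
    ring
  -- The symmetric-difference estimate is used twice: here for the kernel, bounding h by the
  -- potential of A ∆ B, and then for the integral of h itself.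
  have hb : ∀ x, |h x| ≤ surf.real Set.univ / 2 * δ ^ 2 + volume.real (A ∆ B) / δ := fun x => by
    refine (abs_setIntegral_sub_le hA hB (integrableOn_kernel hA' x)
      (integrableOn_kernel hB' x)).trans (le_trans (le_of_eq ?_) (newtonPotential_le hAB x hδ))
    exact integral_congr_ae (Eventually.of_forall fun y => abs_of_nonneg (by positivity))
  have hnn : 0 ≤ surf.real Set.univ / 2 * δ ^ 2 + volume.real (A ∆ B) / δ := by positivity
  rw [e, abs_mul, abs_of_pos (by norm_num : (0 : ℝ) < 2⁻¹)]
  have h2 : |(∫ x in B, h x) - ∫ x in A, h x| ≤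
      volume.real (A ∆ B) * (surf.real Set.univ / 2 * δ ^ 2 + volume.real (A ∆ B) / δ) := by
    refine (abs_setIntegral_sub_le hA hB hiA hiB).trans ?_
    have := norm_setIntegral_le_of_norm_le_const (f := fun x => |h x|) hAB.lt_top
      (fun x _ => by simpa using hb x)
    rw [mul_comm]
    exact (le_abs_self _).trans this
  have := abs_nonneg ((∫ x in B, h x) - ∫ x in A, h x)
  linarith

/-! ### First variation of volume and Coulomb energy -/

lemma starSet_mono {ψ χ : S2 → ℝ} (h : ∀ ω, ψ ω ≤ χ ω) : starSet ψ ⊆ starSet χ :=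
  fun _ hx => lt_of_lt_of_le hx (h _)

lemma volume_starSet_ne_top {ψ : S2 → ℝ} (hψ : Continuous ψ) : volume (starSet ψ) ≠ ∞ := by
  obtain ⟨M, hM, hb⟩ := exists_bound_of_continuous hψ
  refine ((measure_mono (starSet_mono fun ω => (le_abs_self _).trans (hb ω))).trans_lt ?_).ne
  rw [starSet_const]
  exact measure_ball_lt_top

lemma volume_real_starSet {ψ : S2 → ℝ} (hψ : Continuous ψ) (h0 : ∀ ω, 0 ≤ ψ ω) :
    volume.real (starSet ψ) = ∫ ω, ψ ω ^ 3 / 3 ∂surf := by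
  have h1 : volume.real (starSet ψ) = ∫ _ in starSet ψ, (1 : ℝ) := by simp
  rw [h1, setIntegral_starSet hψ.measurable h0 (integrableOn_const (volume_starSet_ne_top hψ))]
  congr 1 with ω
  simp only [mul_one, integral_pow]
  norm_num

lemma volume_real_starSet_pos {ψ : S2 → ℝ} (hψ : Continuous ψ) (h0 : ∀ ω, 0 < ψ ω) :
    0 < volume.real (starSet ψ) := by
  obtain ⟨m, hm, hb⟩ := exists_pos_le_of_continuous hψ h0
  have h1 : 0 < volume (starSet ψ) := by
    refine lt_of_lt_of_le ?_ (measure_mono (starSet_mono hb))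
    rw [starSet_const]
    exact measure_ball_pos _ _ hm
  exact ENNReal.toReal_pos h1.ne' (volume_starSet_ne_top hψ)

open scoped symmDiff in
-- The symmetric difference lies in the shell between φ - s and φ + s with s = |t| sup |u|, whose
-- volume is explicit.
lemma volume_real_symmDiff_starSet_le {φ u : S2 → ℝ} (hφ : Continuous φ) (hpos : ∀ ω, 0 < φ ω)
    (hu : Continuous u) : ∃ C, 0 ≤ C ∧ ∀ᶠ t in 𝓝 (0 : ℝ),
      volume.real (starSet φ ∆ starSet fun ω => φ ω + t * u ω) ≤ C * |t| := by
  obtain ⟨m, hm, hmφ⟩ := exists_pos_le_of_continuous hφ hpos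
  obtain ⟨M, hM, hφM⟩ := exists_bound_of_continuous hφ
  obtain ⟨U, hU, huU⟩ := exists_bound_of_continuous hu
  refine ⟨3 * M ^ 2 * U * surf.real Set.univ, by positivity, ?_⟩
  have ht : Tendsto (fun t : ℝ => |t| * U) (𝓝 0) (𝓝 0) := by
    have : Continuous fun t : ℝ => |t| * U := by fun_prop
    simpa using this.tendsto 0
  filter_upwards [ht.eventually_lt_const hm] with t htm
  have hs : 0 ≤ |t| * U := by positivity
  set s := |t| * U with hsdef
  have habs : ∀ ω, |t * u ω| ≤ s := fun ω => by
    rw [abs_mul, hsdef]; gcongr; exact huU ω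
  have hlow : ∀ ω, φ ω - s ≤ φ ω + t * u ω := fun ω => by linarith [(abs_le.1 (habs ω)).1]
  have hup : ∀ ω, φ ω + t * u ω ≤ φ ω + s := fun ω => by linarith [(abs_le.1 (habs ω)).2]
  have hsub : (starSet φ ∆ starSet fun ω => φ ω + t * u ω) ⊆
      starSet (fun ω => φ ω + s) \ starSet (fun ω => φ ω - s) := by
    rintro x (⟨h1, h2⟩ | ⟨h1, h2⟩)
    · exact ⟨starSet_mono (fun ω => by linarith) h1, fun h => h2 (starSet_mono hlow h)⟩
    · exact ⟨starSet_mono hup h1, fun h => h2 (starSet_mono (fun ω => by linarith) h)⟩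
  have hc1 : Continuous fun ω => φ ω + s := by fun_prop
  have hc2 : Continuous fun ω => φ ω - s := by fun_prop
  calc volume.real (starSet φ ∆ starSet fun ω => φ ω + t * u ω)
      ≤ volume.real (starSet (fun ω => φ ω + s) \ starSet (fun ω => φ ω - s)) :=
        measureReal_mono hsub (measure_ne_top_of_subset Set.sdiff_subset (volume_starSet_ne_top hc1))
    _ = (∫ ω, (φ ω + s) ^ 3 / 3 ∂surf) - ∫ ω, (φ ω - s) ^ 3 / 3 ∂surf := by
        rw [measureReal_sdiff (starSet_mono fun ω => by linarith)
          (measurableSet_starSet hc2.measurable) (volume_starSet_ne_top hc1),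
          volume_real_starSet hc1 fun ω => by linarith [hpos ω],
          volume_real_starSet hc2 fun ω => by linarith [hmφ ω]]
    _ = ∫ ω, ((φ ω + s) ^ 3 / 3 - (φ ω - s) ^ 3 / 3) ∂surf :=
        (integral_sub (integrable_of_continuous (by fun_prop))
          (integrable_of_continuous (by fun_prop))).symm
    _ ≤ ∫ _, 3 * M ^ 2 * s ∂surf := by
        -- The integrand is 2φ²s + 2s³/3, and s ≤ φ ≤ M bounds it by 3M²s.
        refine integral_mono (integrable_of_continuous (by fun_prop)) (integrable_const _) fun ω => ?_
        have h1 : φ ω ^ 2 ≤ M ^ 2 := sq_le_sq' (by linarith [abs_le.1 (hφM ω)]) (abs_le.1 (hφM ω)).2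
        have h2 : s ^ 2 ≤ φ ω ^ 2 := by gcongr; linarith [hmφ ω]
        simp only
        nlinarith
    _ = _ := by simp [hsdef]; ring

lemma exists_radius_forall_pos {φ u : S2 → ℝ} (hφ : Continuous φ) (hpos : ∀ ω, 0 < φ ω)
    (hu : Continuous u) : ∃ ρ, 0 < ρ ∧ ρ ≤ 1 ∧ ∀ t ∈ ball (0 : ℝ) ρ, ∀ ω, 0 < φ ω + t * u ω := by
  obtain ⟨m, hm, hmφ⟩ := exists_pos_le_of_continuous hφ hpos
  obtain ⟨U, hU, huU⟩ := exists_bound_of_continuous hu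
  refine ⟨min 1 (m / U), by positivity, min_le_left _ _, fun t ht ω => ?_⟩
  have h1 : |t| < m / U := by
    rw [mem_ball_zero_iff, Real.norm_eq_abs] at ht
    exact ht.trans_le (min_le_right _ _)
  have h2 : |t * u ω| < m := by
    calc |t * u ω| = |t| * |u ω| := abs_mul _ _
      _ ≤ |t| * U := by gcongr; exact huU ω
      _ < m := (lt_div_iff₀ hU).1 h1
  linarith [(abs_lt.1 h2).1, hmφ ω]

lemma abs_add_mul_le {a b t M U : ℝ} (ha : |a| ≤ M) (hb : |b| ≤ U) (ht : |t| ≤ 1) :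
    |a + t * b| ≤ M + U := by
  have h2 : |t * b| ≤ U := by
    rw [abs_mul]
    exact (mul_le_of_le_one_left (abs_nonneg _) ht).trans hb
  exact (abs_add_le _ _).trans (add_le_add ha h2)

/-- The first variation of the integral of a fixed function over a star-shaped set. -/
lemma hasDerivAt_setIntegral_starSet {φ u : S2 → ℝ} (hφ : Continuous φ) (hpos : ∀ ω, 0 < φ ω)
    (hu : Continuous u) {W : E3 → ℝ} (hW : Continuous W) {B : ℝ} (hB : ∀ x, |W x| ≤ B) :
    HasDerivAt (fun t : ℝ => ∫ x in starSet (fun ω => φ ω + t * u ω), W x)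
      (∫ ω, φ ω ^ 2 * u ω * W (φ ω • (ω : E3)) ∂surf) 0 := by
  obtain ⟨ρ, hρ, hρ1, hρpos⟩ := exists_radius_forall_pos hφ hpos hu
  obtain ⟨M, hM, hφM⟩ := exists_bound_of_continuous hφ
  obtain ⟨U, hU, huU⟩ := exists_bound_of_continuous hu
  have hB0 : 0 ≤ B := (abs_nonneg _).trans (hB 0)
  have hψ : ∀ t : ℝ, Continuous fun ω => φ ω + t * u ω := fun t => by fun_prop
  have hrad : ∀ ω : S2, Continuous fun r : ℝ => r ^ 2 * W (r • (ω : E3)) := fun ω => by fun_prop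
  have key := (hasDerivAt_integral_of_dominated_loc_of_deriv_le (μ := surf) (x₀ := (0 : ℝ))
    (s := ball 0 ρ) (F := fun t ω => ∫ r in 0..φ ω + t * u ω, r ^ 2 * W (r • (ω : E3)))
    (F' := fun t ω => (φ ω + t * u ω) ^ 2 * W ((φ ω + t * u ω) • (ω : E3)) * u ω)
    (bound := fun _ => (M + U) ^ 2 * B * U) (ball_mem_nhds _ hρ)
    (Eventually.of_forall fun t => (continuous_radialIntegral hW (hψ t)).aestronglyMeasurable)
    (integrable_of_continuous (continuous_radialIntegral hW (hψ 0)))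
    (Continuous.aestronglyMeasurable (by fun_prop))
    (Eventually.of_forall fun ω t ht => ?_) (integrable_const _)
    (Eventually.of_forall fun ω t ht => ?_)).2
  · refine (key.congr_of_eventuallyEq ?_).congr_deriv ?_
    · filter_upwards [ball_mem_nhds _ hρ] with t ht
      refine setIntegral_starSet (hψ t).measurable (fun ω => (hρpos t ht ω).le) ?_
      have : IsFiniteMeasure (volume.restrict (starSet fun ω => φ ω + t * u ω)) :=
        ⟨by simpa using (volume_starSet_ne_top (hψ t)).lt_top⟩
      exact Integrable.of_bound hW.aestronglyMeasurable B (Eventually.of_forall hB)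
    · congr 1 with ω
      simp
      ring
  · have ht1 : |t| ≤ 1 := by
      rw [mem_ball_zero_iff, Real.norm_eq_abs] at ht
      exact ht.le.trans hρ1
    rw [norm_mul, norm_mul, norm_pow]
    gcongr
    · exact abs_add_mul_le (hφM ω) (huU ω) ht1
    · exact hB _
    · exact huU ω
  · have h1 := intervalIntegral.integral_hasDerivAt_right
      ((hrad ω).intervalIntegrable 0 (φ ω + t * u ω))
      (hrad ω).aestronglyMeasurable.stronglyMeasurableAtFilter (hrad ω).continuousAt
    have h2 : HasDerivAt (fun t : ℝ => φ ω + t * u ω) (u ω) t := by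
      simpa using ((hasDerivAt_id t).mul_const (u ω)).const_add (φ ω)
    exact h1.comp t h2

lemma hasDerivAt_volume_starSet {φ u : S2 → ℝ} (hφ : Continuous φ) (hpos : ∀ ω, 0 < φ ω)
    (hu : Continuous u) :
    HasDerivAt (fun t : ℝ => volume.real (starSet (fun ω => φ ω + t * u ω)))
      (∫ ω, φ ω ^ 2 * u ω ∂surf) 0 := by
  simpa using hasDerivAt_setIntegral_starSet hφ hpos hu (W := fun _ => 1) continuous_const
    (B := 1) (by simp)

lemma potential_eq (φ : S2 → ℝ) (ω : S2) :
    potential φ ω = newtonPotential (starSet φ) (φ ω • (ω : E3)) := rfl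

/-- The first variation of the Coulomb energy of a star-shaped set. -/
lemma hasDerivAt_coulomb_starSet {φ u : S2 → ℝ} (hφ : Continuous φ) (hpos : ∀ ω, 0 < φ ω)
    (hu : Continuous u) :
    HasDerivAt (fun t : ℝ => (coulomb (starSet (fun ω => φ ω + t * u ω))).toReal)
      (∫ ω, φ ω ^ 2 * u ω * potential φ ω ∂surf) 0 := by
  have hA := volume_starSet_ne_top hφ
  have hψ : ∀ t : ℝ, Continuous fun ω => φ ω + t * u ω := fun t => by fun_prop
  have h1 := hasDerivAt_setIntegral_starSet hφ hpos hu (continuous_newtonPotential hA)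
    (newtonPotential_abs_le hA)
  set G : ℝ → ℝ := fun t => ∫ x in starSet (fun ω => φ ω + t * u ω), newtonPotential (starSet φ) x
    with hG
  set D : ℝ → ℝ := fun t => (coulomb (starSet (fun ω => φ ω + t * u ω))).toReal with hD
  -- G freezes the potential at t = 0; all that remains of D is the quadratic remainder.
  have h2 : HasDerivAt (fun t => D t - G t) 0 0 := by
    obtain ⟨C, hC, hCt⟩ := volume_real_symmDiff_starSet_le hφ hpos hu
    set κ := surf.real Set.univ / 2 with hκ
    have hκ0 : 0 ≤ κ := by positivity
    have hb : ∀ᶠ t in 𝓝 (0 : ℝ), |(D t - G t) - (D 0 - G 0)| ≤ C * (κ + C) * √|t| * |t| := by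
      filter_upwards [hCt, ball_mem_nhds (0 : ℝ) one_pos] with t ht ht1
      have ht1' : |t| ≤ 1 := by simpa using (mem_ball_zero_iff.1 ht1).le
      rcases eq_or_ne t 0 with rfl | h0
      · simp
      have habs : 0 < |t| := abs_pos.2 h0
      have hsq : 0 < √|t| := Real.sqrt_pos.2 habs
      have hss : √|t| * √|t| = |t| := Real.mul_self_sqrt habs.le
      -- With the splitting radius √|t| the second factor of the bound is O(√|t|), and the volume
      -- factor is O(|t|).
      have hle := abs_coulomb_sub_le (measurableSet_starSet hφ.measurable)
        (measurableSet_starSet (hψ t).measurable) hA (volume_starSet_ne_top (hψ t)) hsq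
      have e : (D t - G t) - (D 0 - G 0) = D t - D 0 - (G t - G 0) := by ring
      have hD0 : D 0 = (coulomb (starSet φ)).toReal := by simp [hD]
      have hG0 : G 0 = ∫ x in starSet φ, newtonPotential (starSet φ) x := by simp [hG]
      rw [e, hD0, hG0]
      refine hle.trans ?_
      have hs1 : √|t| ≤ 1 := Real.sqrt_le_one.2 ht1'
      calc _ ≤ C * |t| * (κ * √|t| ^ 2 + C * |t| / √|t|) := by gcongr
        _ = C * |t| * (κ * √|t| * √|t| + C * √|t|) := by
          have : |t| / √|t| = √|t| := by rw [div_eq_iff hsq.ne', hss]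
          rw [mul_div_assoc, this]; ring
        _ ≤ C * |t| * (κ * √|t| * 1 + C * √|t|) := by gcongr
        _ = _ := by ring
    rw [hasDerivAt_iff_isLittleO]
    refine Asymptotics.isLittleO_iff.2 fun c hc => ?_
    have hlim : Tendsto (fun t : ℝ => C * (κ + C) * √|t|) (𝓝 0) (𝓝 0) := by
      have : Continuous fun t : ℝ => C * (κ + C) * √|t| := by fun_prop
      simpa using this.tendsto 0
    filter_upwards [hb, hlim.eventually_lt_const hc] with t h3 h4
    simp only [smul_zero, sub_zero, Real.norm_eq_abs]
    exact h3.trans (by gcongr)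
  have h3 := h2.add h1
  refine (h3.congr_of_eventuallyEq (Eventually.of_forall fun t => ?_)).congr_deriv ?_
  · simp
  · simp [potential_eq]

/-! ### First variation of the perimeter -/

/-- The first variation of the perimeter of a star-shaped Lipschitz set. -/
lemma hasDerivAt_integral_mul_slope {φ u : S2 → ℝ} (hφ : IsLip φ) (hpos : ∀ ω, 0 < φ ω)
    (hu : IsLip u) :
    Integrable (fun ω => u ω * slope φ ω +
      φ ω * ((φ ω * u ω + inner ℝ (sphGrad φ ω) (sphGrad u ω)) / slope φ ω)) surf ∧
    HasDerivAt (fun t : ℝ => ∫ ω, (φ ω + t * u ω) * slope (fun ω => φ ω + t * u ω) ω ∂surf)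
      (∫ ω, (u ω * slope φ ω +
        φ ω * ((φ ω * u ω + inner ℝ (sphGrad φ ω) (sphGrad u ω)) / slope φ ω)) ∂surf) 0 := by
  obtain ⟨ρ, hρ, hρ1, hρpos⟩ := exists_radius_forall_pos hφ.continuous hpos hu.continuous
  obtain ⟨M, hM, hφM⟩ := exists_bound_of_continuous hφ.continuous
  obtain ⟨U, hU, huU⟩ := exists_bound_of_continuous hu.continuous
  obtain ⟨A, hA, hφA⟩ := hφ.norm_sphGrad_le
  obtain ⟨B, hB, huB⟩ := hu.norm_sphGrad_le
  have hmφ := hφ.continuous.measurable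
  have hmu := hu.continuous.measurable
  have hgφ := measurable_sphGrad φ
  have hgu := measurable_sphGrad u
  have hS : ∀ t, |t| ≤ 1 → ∀ ω,
      √((φ ω + t * u ω) ^ 2 + ‖sphGrad φ ω + t • sphGrad u ω‖ ^ 2) ≤ (M + U) + (A + B) := by
    intro t ht ω
    have h1 := abs_add_mul_le (hφM ω) (huU ω) ht
    have h2 : ‖sphGrad φ ω + t • sphGrad u ω‖ ≤ A + B := by
      refine (norm_add_le _ _).trans (add_le_add (hφA ω) ?_)
      rw [norm_smul, Real.norm_eq_abs]
      exact (mul_le_of_le_one_left (norm_nonneg _) ht).trans (huB ω)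
    have h3 : (φ ω + t * u ω) ^ 2 ≤ (M + U) ^ 2 := sq_le_sq' (by linarith [abs_le.1 h1])
      (abs_le.1 h1).2
    have h4 : ‖sphGrad φ ω + t • sphGrad u ω‖ ^ 2 ≤ (A + B) ^ 2 := by gcongr
    rw [Real.sqrt_le_left (by positivity)]
    nlinarith [mul_nonneg (add_pos hM hU).le (add_nonneg hA hB)]
  have hmF : ∀ t, Measurable fun ω => (φ ω + t * u ω) *
      √((φ ω + t * u ω) ^ 2 + ‖sphGrad φ ω + t • sphGrad u ω‖ ^ 2) := fun t => by fun_prop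
  -- The integrand uses ∇φ + t∇u at every point, smooth in t. It agrees with the gradient of φ + tu
  -- only where both functions are differentiable, which is almost everywhere.
  have key := hasDerivAt_integral_of_dominated_loc_of_deriv_le (μ := surf) (x₀ := (0 : ℝ))
    (s := ball 0 ρ) (F := fun t ω => (φ ω + t * u ω) *
      √((φ ω + t * u ω) ^ 2 + ‖sphGrad φ ω + t • sphGrad u ω‖ ^ 2))
    (F' := fun t ω => u ω * √((φ ω + t * u ω) ^ 2 + ‖sphGrad φ ω + t • sphGrad u ω‖ ^ 2) +
      (φ ω + t * u ω) * (((φ ω + t * u ω) * u ω +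
        inner ℝ (sphGrad φ ω + t • sphGrad u ω) (sphGrad u ω)) /
        √((φ ω + t * u ω) ^ 2 + ‖sphGrad φ ω + t • sphGrad u ω‖ ^ 2)))
    (bound := fun _ => U * ((M + U) + (A + B)) + ((M + U) * U + (A + B) * B))
    (ball_mem_nhds _ hρ)
    (Eventually.of_forall fun t => (hmF t).aestronglyMeasurable)
    (Integrable.of_bound (hmF 0).aestronglyMeasurable ((M + U) * ((M + U) + (A + B)))
      (Eventually.of_forall fun ω => ?_))
    (Measurable.aestronglyMeasurable (by fun_prop))
    (Eventually.of_forall fun ω t ht => ?_) (integrable_const _)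
    (Eventually.of_forall fun ω t ht => ?_)
  · simp only [zero_mul, add_zero, zero_smul] at key
    refine ⟨key.1, key.2.congr_of_eventuallyEq (Eventually.of_forall fun t => ?_)⟩
    refine integral_congr_ae ?_
    filter_upwards [hφ.ae_differentiableAt, hu.ae_differentiableAt] with ω h1 h2
    rw [slope, sphGrad_add_mul h1 h2]
  · rw [norm_mul]
    gcongr
    · exact abs_add_mul_le (hφM ω) (huU ω) (by simp)
    · rw [Real.norm_of_nonneg (Real.sqrt_nonneg _)]
      exact hS 0 (by simp) ω
  · have ht1 : |t| ≤ 1 := by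
      rw [mem_ball_zero_iff, Real.norm_eq_abs] at ht
      exact ht.le.trans hρ1
    have hp := hρpos t ht ω
    have h1 := abs_add_mul_le (hφM ω) (huU ω) ht1
    have h2 : ‖sphGrad φ ω + t • sphGrad u ω‖ ≤ A + B := by
      refine (norm_add_le _ _).trans (add_le_add (hφA ω) ?_)
      rw [norm_smul, Real.norm_eq_abs]
      exact (mul_le_of_le_one_left (norm_nonneg _) ht1).trans (huB ω)
    have hSle := hS t ht1 ω
    have hps : φ ω + t * u ω ≤ √((φ ω + t * u ω) ^ 2 + ‖sphGrad φ ω + t • sphGrad u ω‖ ^ 2) :=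
      Real.le_sqrt_of_sq_le (by nlinarith [sq_nonneg ‖sphGrad φ ω + t • sphGrad u ω‖])
    set p := φ ω + t * u ω
    set q := sphGrad φ ω + t • sphGrad u ω
    set S := √(p ^ 2 + ‖q‖ ^ 2)
    have hSpos : 0 < S := hp.trans_le hps
    have h3 : ‖p * u ω + inner ℝ q (sphGrad u ω)‖ ≤ (M + U) * U + (A + B) * B := by
      refine (norm_add_le _ _).trans (add_le_add ?_ ?_)
      · rw [norm_mul]
        gcongr
        · exact h1
        · exact huU ω
      · refine (norm_inner_le_norm _ _).trans ?_
        gcongr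
        exact huB ω
    refine (norm_add_le _ _).trans (add_le_add ?_ ?_)
    · rw [norm_mul, Real.norm_of_nonneg hSpos.le]
      gcongr
      exact huU ω
    · have e : p * ((p * u ω + inner ℝ q (sphGrad u ω)) / S) =
          (p / S) * (p * u ω + inner ℝ q (sphGrad u ω)) := by ring
      rw [e, norm_mul, Real.norm_of_nonneg (by positivity)]
      exact (mul_le_of_le_one_left (norm_nonneg _) ((div_le_one hSpos).2 hps)).trans h3
  · have hp := hρpos t ht ω
    have h2 : HasDerivAt (fun t : ℝ => φ ω + t * u ω) (u ω) t := by
      simpa using ((hasDerivAt_id t).mul_const (u ω)).const_add (φ ω)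
    have h3 : HasDerivAt (fun t : ℝ => sphGrad φ ω + t • sphGrad u ω) (sphGrad u ω) t := by
      simpa using ((hasDerivAt_id t).smul_const (sphGrad u ω)).const_add (sphGrad φ ω)
    have hne : (φ ω + t * u ω) ^ 2 + ‖sphGrad φ ω + t • sphGrad u ω‖ ^ 2 ≠ 0 := by positivity
    have h4 := h2.mul (((h2.pow 2).add h3.norm_sq).sqrt hne)
    refine h4.congr_deriv ?_
    simp
    field_simp
    exact Or.inl trivial

/-! ### Scaling of the energy -/

lemma smul_starSet (ψ : S2 → ℝ) {c : ℝ} (hc : 0 < c) :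
    c • starSet ψ = starSet (fun ω => c * ψ ω) := by
  ext x
  rw [Set.mem_smul_set_iff_inv_smul_mem₀ hc.ne']
  simp only [starSet, Set.mem_ofPred_eq, dir_smul (inv_pos.2 hc), norm_smul, norm_inv,
    Real.norm_of_nonneg hc.le]
  rw [inv_mul_lt_iff₀ hc]

lemma perimeter_starSet_toReal {φ : S2 → ℝ} (hpos : ∀ ω, 0 < φ ω) (hφ : IsLip φ) :
    (perimeter (starSet φ)).toReal = ∫ ω, φ ω * slope φ ω ∂surf := by
  rw [perimeter_starSet hpos hφ, ENNReal.toReal_ofReal]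
  exact integral_nonneg fun ω => mul_nonneg (hpos ω).le (Real.sqrt_nonneg _)

lemma slope_const_mul (φ : S2 → ℝ) {c : ℝ} (hc : 0 < c) (ω : S2) :
    slope (fun ω => c * φ ω) ω = c * slope φ ω := by
  have : (c * φ ω) ^ 2 + ‖c • sphGrad φ ω‖ ^ 2 = c ^ 2 * (φ ω ^ 2 + ‖sphGrad φ ω‖ ^ 2) := by
    rw [norm_smul, Real.norm_of_nonneg hc.le]; ring
  rw [slope, slope, sphGrad_const_mul, this, Real.sqrt_mul (by positivity), Real.sqrt_sq hc.le]

lemma perimeter_smul_starSet {φ : S2 → ℝ} (hpos : ∀ ω, 0 < φ ω) (hφ : IsLip φ) {c : ℝ}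
    (hc : 0 < c) :
    (perimeter (c • starSet φ)).toReal = c ^ 2 * (perimeter (starSet φ)).toReal := by
  rw [smul_starSet φ hc, perimeter_starSet_toReal (fun ω => mul_pos hc (hpos ω))
    ((IsLip.const c).mul hφ), perimeter_starSet_toReal hpos hφ, ← integral_const_mul]
  congr 1 with ω
  rw [slope_const_mul φ hc]
  ring

/-- The Jacobian c³ times the factor c⁻¹ from the kernel. One more Jacobian gives the exponent 5 for
the Coulomb energy. -/
lemma newtonPotential_smul (A : Set E3) {c : ℝ} (hc : 0 < c) (x : E3) :
    newtonPotential (c • A) (c • x) = c ^ 2 * newtonPotential A x := by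
  have h := Measure.setIntegral_comp_smul_of_pos (volume : Measure E3)
    (fun y => 1 / ‖c • x - y‖) A hc
  have h2 : ∫ y in A, 1 / ‖c • x - c • y‖ = c⁻¹ * newtonPotential A x := by
    rw [newtonPotential, ← integral_const_mul]
    congr 1 with y
    rw [← smul_sub, norm_smul, Real.norm_of_nonneg hc.le]
    simp [mul_comm]
  rw [h2] at h
  simp only [finrank_euclideanSpace, Fintype.card_fin, smul_eq_mul] at h
  rw [newtonPotential]
  field_simp at h
  linarith

lemma coulomb_smul {A : Set E3} (hA : volume A ≠ ∞) {c : ℝ} (hc : 0 < c) :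
    (coulomb (c • A)).toReal = c ^ 5 * (coulomb A).toReal := by
  have hcA : volume (c • A) ≠ ∞ := by
    rw [Measure.addHaar_smul]
    exact ENNReal.mul_ne_top ENNReal.ofReal_ne_top hA
  have h := Measure.setIntegral_comp_smul_of_pos (volume : Measure E3)
    (newtonPotential (c • A)) A hc
  simp_rw [newtonPotential_smul A hc, integral_const_mul] at h
  simp only [finrank_euclideanSpace, Fintype.card_fin, smul_eq_mul] at h
  rw [coulomb_toReal hA, coulomb_toReal hcA]
  field_simp at h
  linarith

lemma energy_smul_starSet {φ : S2 → ℝ} (hpos : ∀ ω, 0 < φ ω) (hφ : IsLip φ) {c : ℝ}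
    (hc : 0 < c) :
    energy (c • starSet φ) ≠ ∞ ∧ (energy (c • starSet φ)).toReal =
      c ^ 2 * (∫ ω, φ ω * slope φ ω ∂surf) + c ^ 5 * (coulomb (starSet φ)).toReal := by
  have h1 : perimeter (c • starSet φ) ≠ ∞ := by
    rw [smul_starSet φ hc, perimeter_starSet (fun ω => mul_pos hc (hpos ω))
      ((IsLip.const c).mul hφ)]
    exact ENNReal.ofReal_ne_top
  have h2 : coulomb (c • starSet φ) ≠ ∞ := by
    rw [smul_starSet φ hc, coulomb_eq (volume_starSet_ne_top
      ((IsLip.const c).mul hφ).continuous)]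
    exact ENNReal.ofReal_ne_top
  refine ⟨ENNReal.add_ne_top.2 ⟨h1, h2⟩, ?_⟩
  rw [energy, ENNReal.toReal_add h1 h2, perimeter_smul_starSet hpos hφ hc,
    perimeter_starSet_toReal hpos hφ, coulomb_smul (volume_starSet_ne_top hφ.continuous) hc]

/-! ### The normalized energy and the Euler–Lagrange equation -/

/-- The first variation of the energy under volume-normalized perturbations. -/
lemma hasDerivAt_energy_perturbedSet {φ u : S2 → ℝ} (hφ : IsLip φ) (hpos : ∀ ω, 0 < φ ω)
    (hu : IsLip u) :
    (∀ᶠ t in 𝓝 (0 : ℝ), energy (perturbedSet φ u t) ≠ ∞) ∧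
      HasDerivAt (fun t : ℝ => (energy (perturbedSet φ u t)).toReal)
        ((∫ ω, (u ω * slope φ ω +
          φ ω * ((φ ω * u ω + inner ℝ (sphGrad φ ω) (sphGrad u ω)) / slope φ ω)) ∂surf) +
          (∫ ω, φ ω ^ 2 * u ω * potential φ ω ∂surf) -
          multiplier φ * ∫ ω, φ ω ^ 2 * u ω ∂surf) 0 := by
  obtain ⟨ρ, hρ, hρ1, hρpos⟩ := exists_radius_forall_pos hφ.continuous hpos hu.continuous
  have hψ : ∀ t : ℝ, IsLip fun ω => φ ω + t * u ω := fun t => hφ.add ((IsLip.const t).mul hu)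
  set V : ℝ → ℝ := fun t => volume.real (starSet fun ω => φ ω + t * u ω) with hV
  set c : ℝ → ℝ := fun t => volume.real (starSet φ) ^ (1 / 3 : ℝ) * V t ^ (-(1 / 3) : ℝ) with hc
  have hV0 : V 0 = volume.real (starSet φ) := by simp [hV]
  have hV0pos : 0 < volume.real (starSet φ) := volume_real_starSet_pos hφ.continuous hpos
  have hVpos : ∀ t ∈ ball (0 : ℝ) ρ, 0 < V t := fun t ht =>
    volume_real_starSet_pos (hψ t).continuous (hρpos t ht)
  have hcpos : ∀ t ∈ ball (0 : ℝ) ρ, 0 < c t := fun t ht =>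
    mul_pos (Real.rpow_pos_of_pos hV0pos _) (Real.rpow_pos_of_pos (hVpos t ht) _)
  have hE := fun t ht => energy_smul_starSet (hρpos t ht) (hψ t) (hcpos t ht)
  refine ⟨by filter_upwards [ball_mem_nhds _ hρ] with t ht using (hE t ht).1, ?_⟩
  have hdV := hasDerivAt_volume_starSet hφ.continuous hpos hu.continuous
  have hdD := hasDerivAt_coulomb_starSet hφ.continuous hpos hu.continuous
  have hdP := (hasDerivAt_integral_mul_slope hφ hpos hu).2
  have hc0 : c 0 = 1 := by
    simp only [hc, hV0]
    rw [← Real.rpow_add hV0pos]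
    norm_num
  have hdc : HasDerivAt c (-(1 / 3) * (volume.real (starSet φ))⁻¹ *
      ∫ ω, φ ω ^ 2 * u ω ∂surf) 0 := by
    have h1 := (hdV.rpow_const (p := (-(1 / 3) : ℝ)) (Or.inl (hV0.trans_ne hV0pos.ne'))).const_mul
      (volume.real (starSet φ) ^ (1 / 3 : ℝ))
    refine h1.congr_deriv ?_
    have h2 : volume.real (starSet φ) ^ (1 / 3 : ℝ) * V 0 ^ (-(1 / 3) - 1 : ℝ) =
        (volume.real (starSet φ))⁻¹ := by
      rw [hV0, ← Real.rpow_add hV0pos, ← Real.rpow_neg_one]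
      norm_num
    rw [← h2]
    ring
  -- At t = 0 the scale contributes (2P + 5D)c'(0), which equals -μ ∫ φ²u.
  have hmain := ((hdc.pow 2).mul hdP).add ((hdc.pow 5).mul hdD)
  refine (hmain.congr_of_eventuallyEq ?_).congr_deriv ?_
  · filter_upwards [ball_mem_nhds _ hρ] with t ht
    exact (hE t ht).2
  · simp only [Pi.pow_apply, hc0, zero_mul, add_zero]
    rw [multiplier, perimeter_starSet_toReal hpos hφ]
    norm_num
    ring

/-- The first variation of the perimeter and the Coulomb energy in the direction `u`, written as
the weak form of the equation tested with `φ² u`. -/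
lemma integral_weakForm_eq {φ u : S2 → ℝ} (hφ : IsLip φ) (hpos : ∀ ω, 0 < φ ω) (hu : IsLip u) :
    ∫ ω, (inner ℝ (sphGrad φ ω) (sphGrad (fun ω => φ ω * φ ω * u ω) ω) / (φ ω * slope φ ω)
        + (3 / slope φ ω - slope φ ω / φ ω ^ 2 + potential φ ω) * (φ ω * φ ω * u ω)) ∂surf =
      (∫ ω, (u ω * slope φ ω +
          φ ω * ((φ ω * u ω + inner ℝ (sphGrad φ ω) (sphGrad u ω)) / slope φ ω)) ∂surf) +
          ∫ ω, φ ω ^ 2 * u ω * potential φ ω ∂surf := by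
  have hpc : Continuous fun ω => φ ω ^ 2 * u ω * potential φ ω := by
    have h1 := hφ.continuous
    have h2 := hu.continuous
    have h3 : Continuous (potential φ) :=
      (continuous_newtonPotential (volume_starSet_ne_top h1)).comp
        (by fun_prop : Continuous fun ω : S2 => φ ω • (ω : E3))
    fun_prop
  rw [← integral_add (hasDerivAt_integral_mul_slope hφ hpos hu).1 (integrable_of_continuous hpc)]
  refine integral_congr_ae ?_
  filter_upwards [hφ.ae_differentiableAt, hu.ae_differentiableAt] with ω h1 h2
  have hp := hpos ω
  have hs2 : slope φ ω ^ 2 = φ ω ^ 2 + ‖sphGrad φ ω‖ ^ 2 := Real.sq_sqrt (by positivity)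
  have hs : 0 < slope φ ω := Real.sqrt_pos.2 (by positivity)
  rw [sphGrad_mul (h1.mul h1) h2, sphGrad_mul h1 h1]
  simp only [inner_add_right, inner_smul_right, real_inner_self_eq_norm_sq]
  -- Eliminating |∇φ|² reduces the claim to an algebraic identity in φ, u, the slope and ∇φ · ∇u.
  have hn : ‖sphGrad φ ω‖ ^ 2 = slope φ ω ^ 2 - φ ω ^ 2 := by linarith
  rw [hn]
  field_simp
  ring

/-- Testing the equation with φ²u is criticality in the direction u. Every Lipschitz v has this form
with u = v/φ², which is Lipschitz as φ is bounded below. -/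
theorem isCritical_iff_isWeakSolution {φ : S2 → ℝ} (hpos : ∀ ω, 0 < φ ω) (hφ : IsLip φ) :
    IsCritical φ ↔ IsWeakSolution φ (multiplier φ) := by
  have key : ∀ u : S2 → ℝ, IsLip u →
      (((∀ᶠ t in 𝓝 (0 : ℝ), energy (perturbedSet φ u t) ≠ ∞) ∧
        HasDerivAt (fun t : ℝ => (energy (perturbedSet φ u t)).toReal) 0 0) ↔
      ∫ ω, (inner ℝ (sphGrad φ ω) (sphGrad (fun ω => φ ω * φ ω * u ω) ω) / (φ ω * slope φ ω)
        + (3 / slope φ ω - slope φ ω / φ ω ^ 2 + potential φ ω) * (φ ω * φ ω * u ω)) ∂surf =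
      ∫ ω, multiplier φ * (φ ω * φ ω * u ω) ∂surf) := by
    intro u hu
    obtain ⟨hfin, hder⟩ := hasDerivAt_energy_perturbedSet hφ hpos hu
    rw [integral_weakForm_eq hφ hpos hu, integral_const_mul]
    simp_rw [pow_two] at hder ⊢
    constructor
    · rintro ⟨-, h0⟩
      exact sub_eq_zero.1 (hder.unique h0)
    · intro h
      refine ⟨hfin, hder.congr_deriv (sub_eq_zero.2 h)⟩
  constructor
  · intro h v hv
    have hu : IsLip fun ω => (φ ω * φ ω)⁻¹ * v ω :=
      ((hφ.mul hφ).inv fun ω => mul_pos (hpos ω) (hpos ω)).mul hv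
    have e : (fun ω => φ ω * φ ω * ((φ ω * φ ω)⁻¹ * v ω)) = v := by
      funext ω
      rw [mul_inv_cancel_left₀ (mul_pos (hpos ω) (hpos ω)).ne']
    have hk := (key _ hu).1 (h _ hu)
    rw [e] at hk
    simpa only [mul_inv_cancel_left₀ (mul_pos (hpos _) (hpos _)).ne'] using hk
  · intro h u hu
    exact (key u hu).2 (h _ ((hφ.mul hφ).mul hu))

end LiquidDrop

end

theorem lemma1p1 (φ : LiquidDrop.S2 → ℝ) (hpos : ∀ ω, 0 < φ ω)
    (hLip : ∃ K : NNReal, LipschitzWith K φ) :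
    LiquidDrop.IsCritical φ ↔ LiquidDrop.IsWeakSolution φ (LiquidDrop.multiplier φ) :=
  LiquidDrop.isCritical_iff_isWeakSolution hpos hLip
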